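/- **Setting.** A tracial $W^*$-probability space $(\mathscr A,E)$ is a von Neumann algebra $\mathscr A$ with a weakly continuous (normal), unital, positive, faithful, tracial linear functional $E$. A self-adjoint $x\in\mathscr A$ has as its law the probability measure $\mu$ on $\mathbb R$ with $E[x^m]=\int t^m\,d\mu(t)$ for all $m\ge 0$. The tetilla law is the law of $\mathcal T=\frac1{\sqrt2}(xy+yx)$, where $x,y$ are freely independent centered semicircular variables of variance one. For a free Brownian motion $S$ on $(\mathscr A,E)$, $I_q(f)$ is the Wigner integral of $f\in L^2(\mathbb R_+^q)$: it equals $(S_{b_1}-S_{a_1})\cdots(S_{b_q}-S_{a_q})$ for $f=\mathbf 1_{(a_1,b_1)}\otimes\cdots\otimes\mathbf 1_{(a_q,b_q)}$ with pairwise disjoint intervals, and is extended linearly and by $L^2$-closure. For $g\in L^2(\mathbb R_+^p)$, $f\in L^2(\mathbb R_+^q)$ and $0\le r\le\min(p,q)$, the $r$-th contraction is $$(g\frown_r f)(t_1,\dots,t_{p+q-2r})=\int_{\mathbb R_+^r} g(t_1,\dots,t_{p-r},s_1,\dots,s_r)\,f(s_r,\dots,s_1,t_{p-r+1},\dots,t_{p+q-2r})\,ds_1\cdots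 ds_r .$$ For $l\ge2$, let $\mathcal A_{2,p,l}$ be the set of $(r_1,\dots,r_{l-1})\in\{0,1,2\}^{l-1}$ such that $$2r_1+\dots+2r_{k-1}+r_k\le 2(k-1)+p\quad(1\le k\le l-1),\qquad 2r_1+\dots+2r_{l-1}=2(l-1)+p,$$ and let $\mathcal A^+_{2,p,l}$ be the subset of those whose walk $M_k=2k+p-2r_1-\dots-2r_k$ satisfies $M_k>0$ for $0\le k\le l-2$. For $f\in L^2(\mathbb R_+^2)$ and $g\in L^2(\mathbb R_+^p)$ put $$S_{f,l}(g)=\sum_{(r_1,\dots,r_{l-1})\in\mathcal A_{2,p,l}}(\cdots((g\frown_{r_1}f)\frown_{r_2}f)\cdots)\frown_{r_{l-1}}f ,$$ and let $S^+_{f,l}(g)$ be the same sum over $\mathcal A^+_{2,p,l}$. **Proposition 2.9.** Let $f=\frac1{\sqrt2}\big(\mathbf 1_{[0,1]}\otimes\mathbf 1_{[1,2]}+\mathbf 1_{[1,2]}\otimes\mathbf 1_{[0,1]}\big)$. Then $(f\frown_1f)\frown_1f=\frac12 f$ and $\langle f\frown_1f,f\rangle=0$. For every $m\ge1$ the even moments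 of the tetilla law are $$E[\mathcal T^{2m}]=E[I_2(f)^{2m}]=S_{f,2m}(f),$$ for every choice of $x,y$ and of the free Brownian motion as above; here $I_2(f)$ is a well-defined element of $\mathscr A$. These moments are governed by the following iterative algorithm: for every $m\ge2$, $$\left\{\begin{aligned} S_{f,2m}(f)&=S_{f,2m-2}(f)+S_{f,2m-1}(f\frown_1f)+\sum_{k=1}^{m-1}S^+_{f,2k}(f)\,S_{f,2m-2k}(f),\\ S_{f,2m-1}(f\frown_1f)&=\tfrac12S_{f,2m-2}(f)+\sum_{k=1}^{m-2}S^+_{f,2k}(f)\,S_{f,2m-2k-1}(f\frown_1f), \end{aligned}\right.$$ where the sums over positive walks satisfy $$\left\{\begin{aligned} S^+_{f,2m}(f)&=S^+_{f,2m-1}(f\frown_1f)+\sum_{k=1}^{m-1}S^+_{f,2k}(f)\,S^+_{f,2m-2k}(f),\\ S^+_{f,2m-1}(f\frown_1f)&=\tfrac12S^+_{f,2m-2}(f)+\sum_{k=1}^{m-2}S^+_{f,2k}(f)\,S^+_{f,2m-2k-1}(f\frown_1f), \end{aligned}\right.$$ with the initial conditions $$S_{f,2}(f)=1,\qquad S_{f,3}(f\frown_1f)=\tfrac12,\qquad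 S^+_{f,2}(f)=1,\qquad S^+_{f,3}(f\frown_1f)=\tfrac12 .$$ -/

import Mathlib

open MeasureTheory Filter Topology
open scoped NNReal ENNReal ComplexOrder

universe u

noncomputable section

namespace WignerTetilla

/-! ### Tracial W*-probability spaces -/

section Probability

variable {H : Type u} [NormedAddCommGroup H] [InnerProductSpace ℂ H] [CompleteSpace H]

/-- `(𝒜, E)` is a tracial `W*`-probability space: `E` is a unital, positive, faithful, tracial,
weakly continuous linear functional on the von Neumann algebra `𝒜`. Weak continuity is required on
the unit ball of `𝒜` only (this is normality of `E`). -/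
structure IsTracialState (𝒜 : VonNeumannAlgebra H) (E : 𝒜.toStarSubalgebra →ₗ[ℂ] ℂ) : Prop where
  unital : E 1 = 1
  positive : ∀ x, 0 ≤ E (x * star x)
  faithful : ∀ x, E (x * star x) = 0 → x = 0
  tracial : ∀ x y, E (x * y) = E (y * x)
  weakly_continuous : ∀ (l : Filter 𝒜.toStarSubalgebra) (a : 𝒜.toStarSubalgebra),
    (∀ᶠ b : 𝒜.toStarSubalgebra in l, ‖(b : H →L[ℂ] H)‖ ≤ 1) →
    (∀ ξ η : H, Tendsto (fun b : 𝒜.toStarSubalgebra => inner ℂ ξ ((b : H →L[ℂ] H) η)) l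
      (𝓝 (inner ℂ ξ ((a : H →L[ℂ] H) η)))) →
    Tendsto E l (𝓝 (E a))

end Probability

section Algebraic

variable {R : Type u} [Ring R] [StarRing R] [Algebra ℂ R]

/-- Free independence of a family of unital subalgebras: `E (x₁ ⋯ xₙ) = 0` for `n ≥ 1` whenever the
`xⱼ` are centered elements of the subalgebras and neighbours come from different subalgebras. -/
def FreelyIndependent (E : R →ₗ[ℂ] ℂ) {ι : Type} (B : ι → Subalgebra ℂ R) : Prop :=
  ∀ (n : ℕ) (i : Fin (n + 1) → ι) (x : Fin (n + 1) → R),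
    (∀ j, x j ∈ B (i j)) → (∀ j : Fin n, i j.castSucc ≠ i j.succ) → (∀ j, E (x j) = 0) →
    E (List.ofFn x).prod = 0

/-- `μ` is the distribution of the random variable (self-adjoint element) `x`. -/
structure HasDistribution (E : R →ₗ[ℂ] ℂ) (x : R) (μ : Measure ℝ) : Prop where
  selfAdjoint : IsSelfAdjoint x
  probability : IsProbabilityMeasure μ
  integrable : ∀ m : ℕ, Integrable (fun t : ℝ => t ^ m) μ
  moment : ∀ m : ℕ, E (x ^ m) = ((∫ t, t ^ m ∂μ : ℝ) : ℂ)

/-- The centered semicircular distribution `S(0,t)`; for `t = 0` it is the point mass at `0`. -/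
def semicircular (t : ℝ≥0) : Measure ℝ :=
  if t = 0 then Measure.dirac 0 else
    volume.withDensity fun u : ℝ => ENNReal.ofReal
      ((Set.Ioo (-2 * √(t : ℝ)) (2 * √(t : ℝ))).indicator
        (fun u => 1 / (2 * Real.pi * t) * √(4 * t - u ^ 2)) u)

/-- The random variable `(xy + yx) / √2`. If `x, y` are free and semicircular with variance one,
its distribution is, by definition, the tetilla law. -/
def tetilla (x y : R) : R := (((√2 : ℝ) : ℂ)⁻¹) • (x * y + y * x)

end Algebraic

/-! ### Kernels and contractions -/

/-- Real functions of `n` variables, considered on the orthant `ℝ₊ⁿ`. -/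
abbrev Kernel (n : ℕ) : Type := (Fin n → ℝ) → ℝ

/-- Lebesgue measure on `ℝ₊ⁿ`. -/
def orthant (n : ℕ) : Measure (Fin n → ℝ) :=
  Measure.pi fun _ => volume.restrict (Set.Ici (0 : ℝ))

/-- The `r`-th contraction
`(g ⌢ᵣ f)(t₁,…,t_{p+q-2r}) = ∫ g(t₁,…,t_{p-r},s₁,…,sᵣ) f(sᵣ,…,s₁,t_{p-r+1},…,t_{p+q-2r}) ds`. -/
def contr {p q : ℕ} (r : ℕ) (h : r ≤ p ∧ r ≤ q) (g : Kernel p) (f : Kernel q) :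
    Kernel (p + q - 2 * r) := fun t =>
  ∫ s : Fin r → ℝ,
    g (fun i => if hi : (i : ℕ) < p - r then t ⟨i, by omega⟩ else s ⟨i - (p - r), by omega⟩) *
    f (fun j => if hj : (j : ℕ) < r then s ⟨r - 1 - j, by omega⟩
      else t ⟨(p - r) + (j - r), by omega⟩) ∂(orthant r)

/-- `(…((g ⌢_{r₁} f) ⌢_{r₂} f) …) ⌢_{rₙ} f` for the list `r₁, …, rₙ`, read as a real number. It is
only used when every contraction is well defined and the result has no argument left. -/
def iterContr {q : ℕ} (f : Kernel q) : List ℕ → (p : ℕ) → Kernel p → ℝ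
  | [], _, g => g 0
  | r :: rs, p, g => if h : r ≤ p ∧ r ≤ q then iterContr f rs (p + q - 2 * r) (contr r h g f) else 0

/-- The set `A_{q,p,l}` of the sequences `(r₁,…,r_{l-1}) ∈ {0,…,q}^{l-1}` with
`2r₁+⋯+2r_{k-1}+r_k ≤ (k-1)q+p` for all `k`, and `2r₁+⋯+2r_{l-1} = (l-1)q+p`. -/
def paths (q p l : ℕ) : Finset (Fin (l - 1) → Fin (q + 1)) :=
  Finset.univ.filter fun r =>
    (∀ k : Fin (l - 1), 2 * (∑ i ∈ Finset.Iio k, (r i : ℕ)) + (r k : ℕ) ≤ (k : ℕ) * q + p) ∧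
    2 * (∑ i, (r i : ℕ)) = (l - 1) * q + p

/-- The walk `M_k = kq + p - 2r₁ - ⋯ - 2r_k`, at the times `k = 0, …, l-2`. -/
def walk (q p l : ℕ) (r : Fin (l - 1) → Fin (q + 1)) (k : Fin (l - 1)) : ℤ :=
  (k : ℤ) * q + p - 2 * ∑ i ∈ Finset.Iio k, ((r i : ℕ) : ℤ)

/-- The elements of `A_{q,p,l}` whose walk is strictly positive before its final time `l-1`. -/
def positivePaths (q p l : ℕ) : Finset (Fin (l - 1) → Fin (q + 1)) :=
  (paths q p l).filter fun r => ∀ k, 0 < walk q p l r k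

/-- `S_{f,l}(g)`, the sum of the iterated contractions over `A_{q,p,l}`. -/
def pathSum {q p : ℕ} (f : Kernel q) (l : ℕ) (g : Kernel p) : ℝ :=
  ∑ r ∈ paths q p l, iterContr f (List.ofFn fun k => (r k : ℕ)) p g

/-- `S⁺_{f,l}(g)`, the sum of the iterated contractions over the positive walks in `A_{q,p,l}`. -/
def positivePathSum {q p : ℕ} (f : Kernel q) (l : ℕ) (g : Kernel p) : ℝ :=
  ∑ r ∈ positivePaths q p l, iterContr f (List.ofFn fun k => (r k : ℕ)) p g

/-- The kernel `(1_[0,1] ⊗ 1_[1,2] + 1_[1,2] ⊗ 1_[0,1]) / √2`. -/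
def tetillaKernel : Kernel 2 := fun t =>
  (1 / √2) *
    ((Set.Icc (0 : ℝ) 1).indicator 1 (t 0) * (Set.Icc (1 : ℝ) 2).indicator 1 (t 1) +
      (Set.Icc (1 : ℝ) 2).indicator 1 (t 0) * (Set.Icc (0 : ℝ) 1).indicator 1 (t 1))

/-- The contraction `f ⌢₁ f` of the kernel `f` above. -/
def tetillaKernelContr : Kernel 2 := contr 1 (by norm_num) tetillaKernel tetillaKernel

/-! ### Free Brownian motion and Wigner integrals -/

section Wigner

variable {H : Type u} [NormedAddCommGroup H] [InnerProductSpace ℂ H] [CompleteSpace H]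

/-- `ℬ ∩ 𝒜` as a subalgebra of `𝒜`; it is all of `ℬ` when `ℬ ≤ 𝒜`. -/
def subalgebraIn (𝒜 ℬ : VonNeumannAlgebra H) : Subalgebra ℂ 𝒜.toStarSubalgebra :=
  ℬ.toStarSubalgebra.toSubalgebra.comap (StarSubalgebra.subtype 𝒜.toStarSubalgebra).toAlgHom

/-- `S` is a free Brownian motion on `(𝒜, E)` with respect to the filtration `ℱ`. -/
structure IsFreeBrownianMotion (𝒜 : VonNeumannAlgebra H) (E : 𝒜.toStarSubalgebra →ₗ[ℂ] ℂ)
    (ℱ : ℝ≥0 → VonNeumannAlgebra H) (S : ℝ≥0 → 𝒜.toStarSubalgebra) : Prop where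
  filtration_le : ∀ t, ℱ t ≤ 𝒜
  filtration_mono : Monotone ℱ
  adapted : ∀ t, (S t : H →L[ℂ] H) ∈ ℱ t
  distribution : ∀ t, HasDistribution E (S t) (semicircular t)
  increment_free : ∀ s t, s < t →
    FreelyIndependent E ![Algebra.adjoin ℂ {S t - S s}, subalgebraIn 𝒜 (ℱ s)]
  increment_distribution : ∀ s t, s < t →
    HasDistribution E (S t - S s) (semicircular (t - s))

/-- A product `(a₁,b₁) × ⋯ × (a_q,b_q)` of pairwise disjoint bounded intervals of `ℝ₊`. -/
structure Box (q : ℕ) where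
  a : Fin q → ℝ≥0
  b : Fin q → ℝ≥0
  lt : ∀ i, a i < b i
  disjoint : ∀ i j, i ≠ j → Disjoint (Set.Ioo (a i) (b i)) (Set.Ioo (a j) (b j))

/-- The indicator `1_{(a₁,b₁)} ⊗ ⋯ ⊗ 1_{(a_q,b_q)}` of a box. -/
def Box.kernel {q : ℕ} (Q : Box q) : Kernel q := fun t =>
  ∏ i, (Set.Ioo (Q.a i : ℝ) (Q.b i)).indicator 1 (t i)

/-- The simple function vanishing on diagonals with coefficients `c`. -/
def simpleKernel {q : ℕ} (c : Box q →₀ ℝ) : Kernel q := fun t =>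
  c.sum fun Q w => w * Q.kernel t

/-- The Wigner integral of a simple function: the linear extension of
`1_{(a₁,b₁)} ⊗ ⋯ ⊗ 1_{(a_q,b_q)} ↦ (S_{b₁} - S_{a₁}) ⋯ (S_{b_q} - S_{a_q})`. -/
def simpleIntegral {𝒜 : VonNeumannAlgebra H} (S : ℝ≥0 → 𝒜.toStarSubalgebra) {q : ℕ}
    (c : Box q →₀ ℝ) : 𝒜.toStarSubalgebra :=
  c.sum fun Q w => (w : ℂ) • (List.ofFn fun i => S (Q.b i) - S (Q.a i)).prod

/-- `X` is the Wigner integral `I_q(f)`: there are simple functions `fₙ` vanishing on diagonals with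
`fₙ → f` in `L²(ℝ₊^q)` and `I_q(fₙ) → X` in `L²(𝒜, E)`, where `‖Y‖₂² = E(Y* Y)`. -/
def IsWignerIntegral {𝒜 : VonNeumannAlgebra H} (E : 𝒜.toStarSubalgebra →ₗ[ℂ] ℂ)
    (S : ℝ≥0 → 𝒜.toStarSubalgebra) {q : ℕ} (f : Kernel q) (X : 𝒜.toStarSubalgebra) : Prop :=
  ∀ ε : ℝ, 0 < ε → ∃ c : Box q →₀ ℝ,
    eLpNorm (f - simpleKernel c) 2 (orthant q) < ENNReal.ofReal ε ∧
    √(E (star (X - simpleIntegral S c) * (X - simpleIntegral S c))).re < ε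

end Wigner

end WignerTetilla

end

open WignerTetilla

noncomputable section

namespace WignerTetilla

/-! ### Sums over paths as a recursion on the first step -/

/-! Iterated contractions of `f` or `f ⌢₁ f` with `f` never leave a small family: up to a scalar,
each result is a tensor product of copies of `f` and `f ⌢₁ f`, and is therefore recorded by a stack
of Booleans (`stackKernel`). A contraction with `f` acts on the top cell only. Order 0 pushes a new
`f`; order 1 switches the top cell between `f` and `f ⌢₁ f`, with factor 1 or 1/2; order 2 removes
it, with factor `⟨f, f⟩ = 1` or `⟨f ⌢₁ f, f⟩ = 0`. So the path sums are the purely combinatorial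
`stackSum` (`stepSum_stackKernel`).

The recursions come from splitting off the first step and then applying a first-passage
decomposition (`stackSum_append`): until the cells above a given level have all been removed, they
evolve as a positive walk on their own. A parity argument (`stackSum_eq_zero`) removes half of the
possible passage times.

The moments obey the same rules because right multiplication by the tetilla element performs the
same three moves on the elements `stackElem`. These are combinations of products of Chebyshev
polynomials in alternating letters, which have expectation zero by orthogonality and freeness
(`apply_wordElem`). Only the empty stack survives, so the moments are stack sums started from the
empty stack (`apply_stackElem_mul_tetilla_pow`).

As for the Wigner integral, `f` agrees almost everywhere with a simple function whose integral is
the tetilla element of two consecutive increments. No other element qualifies, by the isometry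
`IsFreeBrownianMotion.map_simpleIntegral` and faithfulness; for two variables the isometry only
needs the fourth-order moments `HasFreeIncrements.map_mul_four`. -/

/-- The sum of the iterated contractions over all walks with `n` steps from `p` to `0`,
by recursion on the first step; if `pos` holds, only walks that are positive before the final time
are taken. -/
def stepSum (pos : Prop) [Decidable pos] {q : ℕ} (f : Kernel q) : ℕ → (p : ℕ) → Kernel p → ℝ
  | 0, p, g => if p = 0 then g 0 else 0
  | n + 1, p, g => if pos ∧ p = 0 then 0 else
      ∑ r : Fin (q + 1), if h : (r : ℕ) ≤ p ∧ (r : ℕ) ≤ q then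
        stepSum pos f n (p + q - 2 * r) (contr r h g f) else 0

/-- Admissibility of a sequence of contraction orders. -/
def Admissible (pos : Prop) (q p n : ℕ) (r : Fin n → Fin (q + 1)) : Prop :=
  ((∀ k : Fin n, 2 * (∑ i ∈ Finset.Iio k, (r i : ℕ)) + (r k : ℕ) ≤ (k : ℕ) * q + p) ∧
    2 * (∑ i, (r i : ℕ)) = n * q + p) ∧
  (pos → ∀ k : Fin n, 0 < (k : ℤ) * q + p - 2 * ∑ i ∈ Finset.Iio k, ((r i : ℕ) : ℤ))

lemma sum_Iio_zero_fin {M : Type*} [AddCommMonoid M] {n : ℕ} (a : Fin (n + 1) → M) :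
    ∑ i ∈ Finset.Iio (0 : Fin (n + 1)), a i = 0 := by
  have : Finset.Iio (0 : Fin (n + 1)) = ∅ := by ext i; simp
  rw [this, Finset.sum_empty]

lemma sum_Iio_succ_fin {M : Type*} [AddCommMonoid M] {n : ℕ} (a : Fin (n + 1) → M) (k : Fin n) :
    ∑ i ∈ Finset.Iio k.succ, a i = a 0 + ∑ i ∈ Finset.Iio k, a i.succ := by
  have h (m : ℕ) (k : Fin m) (b : Fin m → M) :
      ∑ i ∈ Finset.Iio k, b i = ∑ i, if i < k then b i else 0 := by
    rw [← Finset.sum_filter]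
    congr 1
    ext; simp
  rw [h, h, Fin.sum_univ_succ]
  simp

/-- After a first step of order `a` the walk restarts from `p + q - 2 * a`. The bounds `a ≤ p` and
`a ≤ q` keep this natural subtraction from truncating. -/
lemma admissible_cons {pos : Prop} {q p n : ℕ} (a : Fin (q + 1)) (r : Fin n → Fin (q + 1)) :
    Admissible pos q p (n + 1) (Fin.cons a r : Fin (n + 1) → Fin (q + 1)) ↔
      ¬ (pos ∧ p = 0) ∧ (a : ℕ) ≤ p ∧ Admissible pos q (p + q - 2 * a) n r := by
  have ha : (a : ℕ) ≤ q := by omega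
  simp only [Admissible, Fin.forall_fin_succ, sum_Iio_zero_fin, sum_Iio_succ_fin, Fin.sum_univ_succ,
    Fin.cons_zero, Fin.cons_succ, Fin.val_zero, Fin.val_succ, Nat.cast_add, Nat.cast_one,
    Nat.cast_zero, zero_mul, zero_add, mul_zero, sub_zero, add_mul, one_mul, Nat.cast_pos]
  by_cases hap : (a : ℕ) ≤ p
  · have hc : ((p + q - 2 * a : ℕ) : ℤ) = p + q - 2 * a := by omega
    rw [hc]
    have e1 : (∀ k : Fin n, 2 * ((a : ℕ) + ∑ i ∈ Finset.Iio k, (r i : ℕ)) + (r k : ℕ) ≤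
          (k : ℕ) * q + q + p) ↔
        ∀ k : Fin n, 2 * (∑ i ∈ Finset.Iio k, (r i : ℕ)) + (r k : ℕ) ≤
          (k : ℕ) * q + (p + q - 2 * a) := by
      refine forall_congr' fun k => ?_
      generalize (k : ℕ) * q = kq
      omega
    have e2 : (2 * ((a : ℕ) + ∑ i, (r i : ℕ)) = n * q + q + p) ↔
        2 * (∑ i, (r i : ℕ)) = n * q + (p + q - 2 * a) := by
      generalize n * q = kq
      omega
    have e3 : (∀ k : Fin n, 0 < ((k : ℕ) : ℤ) * q + q + p -
          2 * ((a : ℕ) + ∑ i ∈ Finset.Iio k, ((r i : ℕ) : ℤ))) ↔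
        ∀ k : Fin n, 0 < ((k : ℕ) : ℤ) * q + ((p : ℤ) + q - 2 * (a : ℕ)) -
          2 * ∑ i ∈ Finset.Iio k, ((r i : ℕ) : ℤ) := by
      refine forall_congr' fun k => ?_
      generalize ((k : ℕ) : ℤ) * q = kq
      omega
    rw [e1, e2, e3]
    have : (0 < p) ↔ ¬ p = 0 := Nat.pos_iff_ne_zero
    rw [this]
    simp only [hap, true_and]
    tauto
  · simp [hap]

lemma sum_fin_succ_fun {M α : Type*} [AddCommMonoid M] [Fintype α] {n : ℕ}
    (F : (Fin (n + 1) → α) → M) :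
    ∑ r, F r = ∑ a : α, ∑ r : Fin n → α, F (Fin.cons a r) := by
  rw [← (Fin.consEquiv fun _ : Fin (n + 1) => α).sum_comp, Fintype.sum_prod_type]
  rfl

open Classical in
lemma stepSum_eq_sum (pos : Prop) [Decidable pos] {q : ℕ} (f : Kernel q) (n : ℕ) :
    ∀ (p : ℕ) (g : Kernel p), stepSum pos f n p g =
      ∑ r : Fin n → Fin (q + 1), if Admissible pos q p n r then
        iterContr f (List.ofFn fun k => (r k : ℕ)) p g else 0 := by
  induction n with
  | zero =>
    intro p g
    simp [stepSum, Admissible, iterContr, eq_comm]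
  | succ n ih =>
    intro p g
    rw [sum_fin_succ_fun, stepSum]
    simp only [admissible_cons, List.ofFn_succ, Fin.cons_zero, Fin.cons_succ,
      iterContr]
    by_cases h0 : pos ∧ p = 0
    · simp [h0]
    · rw [if_neg h0]
      refine Finset.sum_congr rfl fun a _ => ?_
      have ha : (a : ℕ) ≤ q := by omega
      by_cases hap : (a : ℕ) ≤ p
      · simp only [hap, ha, h0, and_self, dite_true, not_false_eq_true, true_and, ih]
      · simp [hap]

lemma pathSum_succ_eq_stepSum {q p : ℕ} (f : Kernel q) (n : ℕ) (g : Kernel p) :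
    pathSum f (n + 1) g = stepSum False f n p g := by
  classical
  rw [stepSum_eq_sum, pathSum, paths, Finset.sum_filter]
  refine Finset.sum_congr rfl fun r _ => if_congr ?_ rfl rfl
  simp [Admissible]

lemma positivePathSum_succ_eq_stepSum {q p : ℕ} (f : Kernel q) (n : ℕ) (g : Kernel p) :
    positivePathSum f (n + 1) g = stepSum True f n p g := by
  classical
  rw [stepSum_eq_sum, positivePathSum, positivePaths, paths, Finset.filter_filter,
    Finset.sum_filter]
  refine Finset.sum_congr rfl fun r _ => if_congr ?_ rfl rfl
  simp [Admissible, walk]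

lemma contr_const_mul {p q : ℕ} (r : ℕ) (h : r ≤ p ∧ r ≤ q) (c : ℝ) (g : Kernel p)
    (f : Kernel q) : contr r h (fun t => c * g t) f = fun t => c * contr r h g f t := by
  funext t
  simp only [contr, mul_assoc, integral_const_mul]

/-- Contractions of orders 1 and 2 reproduce a stack kernel only up to a scalar, which has to be
carried through the remaining steps. -/
lemma stepSum_const_mul (pos : Prop) [Decidable pos] {q : ℕ} (f : Kernel q) (n : ℕ) :
    ∀ (p : ℕ) (c : ℝ) (g : Kernel p),
      stepSum pos f n p (fun t => c * g t) = c * stepSum pos f n p g := by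
  induction n with
  | zero => intro p c g; simp [stepSum]
  | succ n ih =>
    intro p c g
    simp only [stepSum, contr_const_mul, ih, mul_ite, mul_zero, Finset.mul_sum, mul_dite]

/-! ### Kernels encoded by stacks -/

/-- The indicator of the interval `[a, a + 1]`. -/
def unitInd (a : ℝ) : ℝ → ℝ := (Set.Icc a (a + 1)).indicator 1

lemma integrable_unitInd_mul (a b : ℝ) :
    Integrable (fun s => unitInd a s * unitInd b s) (volume.restrict (Set.Ici (0 : ℝ))) := by
  have : (fun s => unitInd a s * unitInd b s) =
      (Set.Icc a (a + 1) ∩ Set.Icc b (b + 1)).indicator 1 := by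
    funext s
    simp only [unitInd, Set.inter_indicator_one, Pi.mul_apply]
  rw [this]
  refine (IntegrableOn.integrable_indicator ?_ (measurableSet_Icc.inter measurableSet_Icc))
  refine integrableOn_const ?_
  refine ne_of_lt (lt_of_le_of_lt (Measure.restrict_apply_le _ _) ?_)
  exact lt_of_le_of_lt (measure_mono Set.inter_subset_left) measure_Icc_lt_top

lemma integral_unitInd_mul (a b : ℝ) (ha : 0 ≤ a) :
    ∫ s in Set.Ici (0 : ℝ), unitInd a s * unitInd b s =
      max (min (a + 1) (b + 1) - max a b) 0 := by
  have : (fun s => unitInd a s * unitInd b s) =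
      (Set.Icc a (a + 1) ∩ Set.Icc b (b + 1)).indicator 1 := by
    funext s
    simp only [unitInd, Set.inter_indicator_one, Pi.mul_apply]
  rw [this, integral_indicator_one (measurableSet_Icc.inter measurableSet_Icc), measureReal_def,
    Measure.restrict_apply (measurableSet_Icc.inter measurableSet_Icc),
    Set.inter_eq_left.2, Set.Icc_inter_Icc, Real.volume_Icc, ENNReal.toReal_ofReal']
  intro s hs
  exact ha.trans hs.1.1

lemma integral_unitInd_zero_zero :
    ∫ s in Set.Ici (0 : ℝ), unitInd 0 s * unitInd 0 s = 1 := by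
  rw [integral_unitInd_mul _ _ le_rfl]; norm_num

lemma integral_unitInd_one_one :
    ∫ s in Set.Ici (0 : ℝ), unitInd 1 s * unitInd 1 s = 1 := by
  rw [integral_unitInd_mul _ _ zero_le_one]; norm_num

lemma integral_unitInd_zero_one :
    ∫ s in Set.Ici (0 : ℝ), unitInd 0 s * unitInd 1 s = 0 := by
  rw [integral_unitInd_mul _ _ le_rfl]; norm_num

/-- The kernel `f` (for `true`) and its contraction `f ⌢₁ f` (for `false`). -/
def cell : Bool → ℝ → ℝ → ℝ
  | true, u, v => (1 / √2) * (unitInd 0 u * unitInd 1 v + unitInd 1 u * unitInd 0 v)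
  | false, u, v => (1 / 2) * (unitInd 0 u * unitInd 0 v + unitInd 1 u * unitInd 1 v)

/-- The result of the contraction `⌢₁ f` on the top of a stack is a multiple of a cell. -/
def cellCoeff : Bool → ℝ
  | true => 1
  | false => 1 / 2

lemma tetillaKernel_eq_cell (t : Fin 2 → ℝ) : tetillaKernel t = cell true (t 0) (t 1) := by
  simp only [tetillaKernel, cell, unitInd, zero_add, one_add_one_eq_two]

lemma inv_sqrt_two_mul_self : (1 / √2 : ℝ) * (1 / √2) = 1 / 2 := by
  rw [div_mul_div_comm, one_mul, Real.mul_self_sqrt zero_le_two]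

lemma integral_add_four {α : Type*} [MeasurableSpace α] {μ : Measure α} {f₁ f₂ f₃ f₄ : α → ℝ}
    (h₁ : Integrable f₁ μ) (h₂ : Integrable f₂ μ) (h₃ : Integrable f₃ μ) (h₄ : Integrable f₄ μ) :
    ∫ x, (f₁ x + f₂ x) + (f₃ x + f₄ x) ∂μ =
      ((∫ x, f₁ x ∂μ) + ∫ x, f₂ x ∂μ) + ((∫ x, f₃ x ∂μ) + ∫ x, f₄ x ∂μ) := by
  have h := integral_add (h₁.add h₂) (h₃.add h₄)
  simp only [Pi.add_apply] at h
  rw [h, integral_add h₁ h₂, integral_add h₃ h₄]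

lemma integral_quad (a b c d : ℝ) :
    ∫ s in Set.Ici (0 : ℝ), (a * (unitInd 0 s * unitInd 0 s) + b * (unitInd 0 s * unitInd 1 s)) +
      (c * (unitInd 0 s * unitInd 1 s) + d * (unitInd 1 s * unitInd 1 s)) = a + d := by
  have h (x y z : ℝ) := (integrable_unitInd_mul x y).const_mul z
  rw [integral_add_four (h _ _ _) (h _ _ _) (h _ _ _) (h _ _ _)]
  simp only [integral_const_mul, integral_unitInd_zero_zero, integral_unitInd_one_one,
    integral_unitInd_zero_one]
  ring

/-- In the orthonormal pair of indicators of `[0,1]` and `[1,2]`, the cell `true` is the swap matrix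
divided by `√2` and `false` is half the identity; the integral is a matrix product. -/
lemma integral_cell_mul_cell (b : Bool) (u v : ℝ) :
    ∫ s in Set.Ici (0 : ℝ), cell b u s * cell true s v = cellCoeff b * cell (!b) u v := by
  cases b
  · have := integral_quad ((1 / 2) * (1 / √2) * (unitInd 0 u * unitInd 1 v))
      ((1 / 2) * (1 / √2) * (unitInd 0 u * unitInd 0 v))
      ((1 / 2) * (1 / √2) * (unitInd 1 u * unitInd 1 v))
      ((1 / 2) * (1 / √2) * (unitInd 1 u * unitInd 0 v))
    calc _ = _ := by
          refine Eq.trans (integral_congr_ae (ae_of_all _ fun s => ?_)) this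
          simp only [cell]; ring
      _ = _ := by simp only [cell, cellCoeff, Bool.not_false]; ring
  · have := integral_quad ((1 / √2) * (1 / √2) * (unitInd 1 u * unitInd 1 v))
      ((1 / √2) * (1 / √2) * (unitInd 1 u * unitInd 0 v))
      ((1 / √2) * (1 / √2) * (unitInd 0 u * unitInd 1 v))
      ((1 / √2) * (1 / √2) * (unitInd 0 u * unitInd 0 v))
    calc _ = _ := by
          refine Eq.trans (integral_congr_ae (ae_of_all _ fun s => ?_)) this
          simp only [cell]; ring
      _ = _ := by
        simp only [inv_sqrt_two_mul_self, cell, cellCoeff, Bool.not_true]; ring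

lemma integral_orthant_two_prod (f g : ℝ → ℝ) :
    ∫ s, f (s 0) * g (s 1) ∂(orthant 2) =
      (∫ x in Set.Ici (0 : ℝ), f x) * ∫ x in Set.Ici (0 : ℝ), g x := by
  have := integral_fintype_prod_eq_prod (𝕜 := ℝ) (ι := Fin 2) ![f, g]
    (μ := fun _ => volume.restrict (Set.Ici (0 : ℝ)))
  simpa [orthant, Fin.prod_univ_two] using this

lemma integrable_orthant_two_prod {f g : ℝ → ℝ}
    (hf : Integrable f (volume.restrict (Set.Ici (0 : ℝ))))
    (hg : Integrable g (volume.restrict (Set.Ici (0 : ℝ)))) :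
    Integrable (fun s : Fin 2 → ℝ => f (s 0) * g (s 1)) (orthant 2) := by
  have := Integrable.fintype_prod (𝕜 := ℝ) (ι := Fin 2) (f := ![f, g])
    (μ := fun _ => volume.restrict (Set.Ici (0 : ℝ))) (by
      intro i; fin_cases i
      · exact hf
      · exact hg)
  simpa [orthant, Fin.prod_univ_two] using this

lemma integral_orthant_one (f : ℝ → ℝ) :
    ∫ s, f (s 0) ∂(orthant 1) = ∫ x in Set.Ici (0 : ℝ), f x := by
  have := integral_fintype_prod_eq_prod (𝕜 := ℝ) (ι := Fin 1) ![f]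
    (μ := fun _ => volume.restrict (Set.Ici (0 : ℝ)))
  simpa [orthant] using this

lemma integral_cell_swap (b : Bool) :
    ∫ s, cell b (s 0) (s 1) * cell true (s 1) (s 0) ∂(orthant 2) = if b then 1 else 0 := by
  have h (c x y x' y' : ℝ) := (integrable_orthant_two_prod (integrable_unitInd_mul x y)
    (integrable_unitInd_mul x' y')).const_mul c
  have key (a b c d : ℝ) : ∫ s,
      (a * ((unitInd 0 (s 0) * unitInd 0 (s 0)) * (unitInd 1 (s 1) * unitInd 1 (s 1))) +
      b * ((unitInd 1 (s 0) * unitInd 1 (s 0)) * (unitInd 0 (s 1) * unitInd 0 (s 1)))) +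
      (c * ((unitInd 0 (s 0) * unitInd 1 (s 0)) * (unitInd 0 (s 1) * unitInd 1 (s 1))) +
      d * ((unitInd 0 (s 0) * unitInd 0 (s 0)) * (unitInd 0 (s 1) * unitInd 1 (s 1))))
        ∂(orthant 2) = a + b := by
    rw [integral_add_four (h _ _ _ _ _) (h _ _ _ _ _) (h _ _ _ _ _) (h _ _ _ _ _)]
    simp only [integral_const_mul,
      integral_orthant_two_prod (fun x => unitInd 0 x * unitInd 0 x)
        (fun x => unitInd 1 x * unitInd 1 x),
      integral_orthant_two_prod (fun x => unitInd 1 x * unitInd 1 x)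
        (fun x => unitInd 0 x * unitInd 0 x),
      integral_orthant_two_prod (fun x => unitInd 0 x * unitInd 1 x)
        (fun x => unitInd 0 x * unitInd 1 x),
      integral_orthant_two_prod (fun x => unitInd 0 x * unitInd 0 x)
        (fun x => unitInd 0 x * unitInd 1 x),
      integral_unitInd_zero_zero, integral_unitInd_one_one, integral_unitInd_zero_one]
    ring
  have key2 (a b c d : ℝ) : ∫ s,
      (a * ((unitInd 0 (s 0) * unitInd 0 (s 0)) * (unitInd 0 (s 1) * unitInd 1 (s 1))) +
      b * ((unitInd 0 (s 0) * unitInd 1 (s 0)) * (unitInd 0 (s 1) * unitInd 0 (s 1)))) +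
      (c * ((unitInd 1 (s 0) * unitInd 1 (s 0)) * (unitInd 0 (s 1) * unitInd 1 (s 1))) +
      d * ((unitInd 0 (s 0) * unitInd 1 (s 0)) * (unitInd 1 (s 1) * unitInd 1 (s 1))))
        ∂(orthant 2) = 0 := by
    rw [integral_add_four (h _ _ _ _ _) (h _ _ _ _ _) (h _ _ _ _ _) (h _ _ _ _ _)]
    simp only [integral_const_mul,
      integral_orthant_two_prod (fun x => unitInd 0 x * unitInd 0 x)
        (fun x => unitInd 0 x * unitInd 1 x),
      integral_orthant_two_prod (fun x => unitInd 0 x * unitInd 1 x)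
        (fun x => unitInd 0 x * unitInd 0 x),
      integral_orthant_two_prod (fun x => unitInd 1 x * unitInd 1 x)
        (fun x => unitInd 0 x * unitInd 1 x),
      integral_orthant_two_prod (fun x => unitInd 0 x * unitInd 1 x)
        (fun x => unitInd 1 x * unitInd 1 x),
      integral_unitInd_zero_zero, integral_unitInd_one_one, integral_unitInd_zero_one]
    ring
  cases b
  · refine Eq.trans (integral_congr_ae (ae_of_all _ fun s => ?_)) (key2 (1 / 2 * (1 / √2))
      (1 / 2 * (1 / √2)) (1 / 2 * (1 / √2)) (1 / 2 * (1 / √2)))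
    simp only [cell]; ring
  -- The two mixed terms of the square coincide, hence the third coefficient is doubled and the
  -- fourth is zero.
  · refine Eq.trans (integral_congr_ae (ae_of_all _ fun s => ?_))
      ((key ((1 / √2) * (1 / √2)) ((1 / √2) * (1 / √2)) (2 * ((1 / √2) * (1 / √2))) 0).trans ?_)
    · simp only [cell]; ring
    · rw [inv_sqrt_two_mul_self]; norm_num

/-- The tensor product of the cells of a stack, whose head takes the last two variables. -/
def stackFun : List Bool → (ℕ → ℝ) → ℝ
  | [], _ => 1
  | b :: s, τ => stackFun s τ * cell b (τ (2 * s.length)) (τ (2 * s.length + 1))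

lemma stackFun_congr (s : List Bool) {τ τ' : ℕ → ℝ} (h : ∀ i < 2 * s.length, τ i = τ' i) :
    stackFun s τ = stackFun s τ' := by
  induction s with
  | nil => rfl
  | cons b s ih =>
    simp only [List.length_cons] at h
    rw [stackFun, stackFun, ih fun i hi => h i (by omega), h _ (by omega), h _ (by omega)]

/-- A vector, continued by zero. -/
def extendZero {p : ℕ} (t : Fin p → ℝ) (i : ℕ) : ℝ := if h : i < p then t ⟨i, h⟩ else 0

lemma extendZero_of_lt {p : ℕ} (t : Fin p → ℝ) {i : ℕ} (h : i < p) :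
    extendZero t i = t ⟨i, h⟩ := dif_pos h

/-- The kernel of a stack; it is meant for `p = 2 * s.length`. -/
def stackKernel (p : ℕ) (s : List Bool) : Kernel p := fun t => stackFun s (extendZero t)

lemma contr_zero_stackKernel {p : ℕ} (s : List Bool) (hp : p = 2 * s.length) (h : 0 ≤ p ∧ 0 ≤ 2) :
    contr 0 h (stackKernel p s) tetillaKernel = stackKernel (p + 2 - 2 * 0) (true :: s) := by
  subst hp
  funext t
  -- The integral over no variables is evaluation at a point, so order 0 is the plain tensor
  -- product.
  have : IsProbabilityMeasure (orthant 0) := by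
    rw [orthant, Measure.pi_of_empty]; infer_instance
  simp only [contr]
  rw [integral_congr_ae (g := fun _ => stackKernel _ (true :: s) t)]
  · simp
  · refine ae_of_all _ fun u => ?_
    simp only [stackKernel, stackFun, tetillaKernel_eq_cell]
    rw [extendZero_of_lt t (by omega), extendZero_of_lt t (by omega)]
    congr 1
    refine stackFun_congr s fun i hi => ?_
    rw [extendZero_of_lt _ hi, extendZero_of_lt _ (by omega)]
    simp [hi]

/-- The contracted variable is the last one of the kernel and belongs to the top cell, so the lower
cells factor out of the integral. -/
lemma contr_one_stackKernel {p : ℕ} (b : Bool) (s : List Bool) (hp : p = 2 * (b :: s).length)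
    (h : 1 ≤ p ∧ 1 ≤ 2) :
    contr 1 h (stackKernel p (b :: s)) tetillaKernel =
      fun t => cellCoeff b * stackKernel (p + 2 - 2 * 1) ((!b) :: s) t := by
  rw [List.length_cons] at hp
  subst hp
  funext t
  simp only [contr]
  have h0 : 2 * s.length < 2 * (s.length + 1) + 2 - 2 * 1 := by omega
  have h1 : 2 * s.length + 1 < 2 * (s.length + 1) + 2 - 2 * 1 := by omega
  refine Eq.trans (integral_congr_ae (g := fun u : Fin 1 → ℝ => (fun x : ℝ =>
    stackFun s (extendZero t) * (cell b (extendZero t (2 * s.length)) x *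
      cell true x (extendZero t (2 * s.length + 1)))) (u 0)) (ae_of_all _ fun u => ?_)) ?_
  · simp only [stackKernel, stackFun, tetillaKernel_eq_cell]
    rw [mul_assoc, extendZero_of_lt t h0, extendZero_of_lt t h1, extendZero_of_lt _ (by omega),
      extendZero_of_lt _ (by omega)]
    have e0 : 2 * s.length < 2 * (s.length + 1) - 1 := by omega
    have e1 : ¬ (2 * s.length + 1 < 2 * (s.length + 1) - 1) := by omega
    simp only [e0, e1, dite_true, dite_false]
    refine congr (congrArg _ (stackFun_congr s fun i hi => ?_)) ?_
    · rw [extendZero_of_lt _ (by omega), extendZero_of_lt _ (by omega)]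
      exact dif_pos (by simp only; omega)
    · have e2 : 2 * s.length + 1 - (2 * (s.length + 1) - 1) = 0 := by omega
      simp only [e2]
      congr 1
  · rw [integral_orthant_one (fun x => stackFun s (extendZero t) *
      (cell b (extendZero t (2 * s.length)) x * cell true x (extendZero t (2 * s.length + 1)))),
      integral_const_mul, integral_cell_mul_cell, stackKernel, stackFun]
    ring

lemma contr_two_stackKernel {p : ℕ} (b : Bool) (s : List Bool) (hp : p = 2 * (b :: s).length)
    (h : 2 ≤ p ∧ 2 ≤ 2) :
    contr 2 h (stackKernel p (b :: s)) tetillaKernel =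
      fun t => (if b then 1 else 0) * stackKernel (p + 2 - 2 * 2) s t := by
  rw [List.length_cons] at hp
  subst hp
  funext t
  simp only [contr]
  refine Eq.trans (integral_congr_ae (g := fun u : Fin 2 → ℝ =>
    stackFun s (extendZero t) * (cell b (u 0) (u 1) * cell true (u 1) (u 0)))
      (ae_of_all _ fun u => ?_)) ?_
  · simp only [stackKernel, stackFun, tetillaKernel_eq_cell]
    rw [mul_assoc, extendZero_of_lt _ (by omega), extendZero_of_lt _ (by omega)]
    have e0 : ¬ 2 * s.length < 2 * (s.length + 1) - 2 := by omega
    have e1 : ¬ (2 * s.length + 1 < 2 * (s.length + 1) - 2) := by omega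
    simp only [e0, e1, dite_false]
    refine congr (congrArg _ (stackFun_congr s fun i hi => ?_)) ?_
    · rw [extendZero_of_lt _ (by omega), extendZero_of_lt _ (by omega)]
      exact dif_pos (by simp only; omega)
    · congr 2
      all_goals (congr 1; simp [Fin.ext_iff]; try omega)
  · rw [integral_const_mul, integral_cell_swap, stackKernel, mul_comm]

/-- The sum over walks started at a stack, as a recursion on stacks. -/
def stackSum (pos : Prop) [Decidable pos] : ℕ → List Bool → ℝ
  | 0, s => if s = [] then 1 else 0
  | n + 1, [] => if pos then 0 else stackSum pos n [true]
  | n + 1, b :: s => stackSum pos n (true :: b :: s) + cellCoeff b * stackSum pos n ((!b) :: s) +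
      (if b then 1 else 0) * stackSum pos n s

lemma stepSum_stackKernel (pos : Prop) [Decidable pos] (n : ℕ) :
    ∀ (p : ℕ) (s : List Bool), p = 2 * s.length →
      stepSum pos tetillaKernel n p (stackKernel p s) = stackSum pos n s := by
  induction n with
  | zero =>
    intro p s hp
    cases s with
    | nil => simp [stepSum, stackSum, hp, stackKernel, stackFun]
    | cons b s => simp [stepSum, stackSum, hp]
  | succ n ih =>
    intro p s hp
    cases s with
    | nil =>
      simp only [List.length_nil, mul_zero] at hp
      subst hp
      simp only [stepSum, and_true, stackSum]
      by_cases hpos : pos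
      · simp [hpos]
      · have h1 : ¬ (((1 : Fin 3) : ℕ) ≤ 0 ∧ ((1 : Fin 3) : ℕ) ≤ 2) := by decide
        have h2 : ¬ (((2 : Fin 3) : ℕ) ≤ 0 ∧ ((2 : Fin 3) : ℕ) ≤ 2) := by decide
        have h0 : (((0 : Fin 3) : ℕ) ≤ 0 ∧ ((0 : Fin 3) : ℕ) ≤ 2) := by decide
        rw [if_neg hpos, if_neg hpos, Fin.sum_univ_three, dif_pos h0, dif_neg h1, dif_neg h2, add_zero, add_zero,
          ← ih (0 + 2 - 2 * 0) [true] rfl]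
        congr 1
        exact contr_zero_stackKernel (p := 0) [] rfl h0
    | cons b s =>
      have hp' := hp
      rw [List.length_cons] at hp'
      have hp0 : ¬ (pos ∧ p = 0) := by rintro ⟨-, h⟩; omega
      have h0 : (((0 : Fin 3) : ℕ) ≤ p ∧ ((0 : Fin 3) : ℕ) ≤ 2) := by simp
      have h1 : (((1 : Fin 3) : ℕ) ≤ p ∧ ((1 : Fin 3) : ℕ) ≤ 2) := by
        simp only [Fin.val_one]; omega
      have h2 : (((2 : Fin 3) : ℕ) ≤ p ∧ ((2 : Fin 3) : ℕ) ≤ 2) := by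
        simp only [Fin.val_two]; omega
      rw [stepSum, if_neg hp0, Fin.sum_univ_three, dif_pos h0, dif_pos h1, dif_pos h2, stackSum]
      congr 1
      · congr 1
        · rw [← ih (p + 2 - 2 * 0) (true :: b :: s) (by simp only [List.length_cons]; omega)]
          congr 1
          exact contr_zero_stackKernel (p := p) _ hp h0
        · rw [← ih (p + 2 - 2 * 1) ((!b) :: s) (by simp only [List.length_cons]; omega),
            ← stepSum_const_mul]
          congr 1
          exact contr_one_stackKernel (p := p) _ _ hp h1
      · rw [← ih (p + 2 - 2 * 2) s (by omega), ← stepSum_const_mul]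
        congr 1
        exact contr_two_stackKernel (p := p) _ _ hp h2

lemma tetillaKernel_eq_stackKernel : tetillaKernel = stackKernel 2 [true] := by
  funext t
  simp [tetillaKernel_eq_cell, stackKernel, stackFun, extendZero]

lemma tetillaKernelContr_eq_stackKernel : tetillaKernelContr = stackKernel 2 [false] := by
  have := contr_one_stackKernel (p := 2) true [] rfl (by norm_num)
  rw [← tetillaKernel_eq_stackKernel] at this
  refine this.trans ?_
  simp [cellCoeff]

lemma contr_tetillaKernelContr :
    contr 1 (by norm_num) tetillaKernelContr tetillaKernel = fun t => (1 / 2) * tetillaKernel t := by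
  rw [tetillaKernelContr_eq_stackKernel, contr_one_stackKernel (p := 2) false [] rfl,
    tetillaKernel_eq_stackKernel]
  rfl

lemma integral_tetillaKernelContr_mul :
    ∫ t, tetillaKernelContr t * tetillaKernel t ∂(orthant 2) = 0 := by
  have := integral_cell_swap false
  simp only [Bool.false_eq_true, if_false] at this
  refine Eq.trans (integral_congr_ae (ae_of_all _ fun t => ?_)) this
  simp only [tetillaKernel_eq_cell, tetillaKernelContr_eq_stackKernel, stackKernel, stackFun,
    List.length_nil, mul_zero, zero_add, one_mul]
  simp only [extendZero, cell, Nat.ofNat_pos, one_lt_two, dite_true, Fin.mk_zero, Fin.mk_one]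
  ring

lemma pathSum_tetillaKernel (n : ℕ) :
    pathSum tetillaKernel (n + 1) tetillaKernel = stackSum False n [true] := by
  rw [pathSum_succ_eq_stepSum, ← stepSum_stackKernel False n 2 [true] rfl,
    ← tetillaKernel_eq_stackKernel]

lemma pathSum_tetillaKernelContr (n : ℕ) :
    pathSum tetillaKernel (n + 1) tetillaKernelContr = stackSum False n [false] := by
  rw [pathSum_succ_eq_stepSum, ← stepSum_stackKernel False n 2 [false] rfl,
    ← tetillaKernelContr_eq_stackKernel]

lemma positivePathSum_tetillaKernel (n : ℕ) :
    positivePathSum tetillaKernel (n + 1) tetillaKernel = stackSum True n [true] := by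
  rw [positivePathSum_succ_eq_stepSum, ← stepSum_stackKernel True n 2 [true] rfl,
    ← tetillaKernel_eq_stackKernel]

lemma positivePathSum_tetillaKernelContr (n : ℕ) :
    positivePathSum tetillaKernel (n + 1) tetillaKernelContr = stackSum True n [false] := by
  rw [positivePathSum_succ_eq_stepSum, ← stepSum_stackKernel True n 2 [false] rfl,
    ← tetillaKernelContr_eq_stackKernel]

/-! ### The recursions for sums over stacks -/

section StackSum

variable (pos : Prop) [Decidable pos]

/-- First-passage decomposition: `k` is the first time at which all of `s` has been removed. Before
it the cells of `s'` are untouched, so the upper part is a positive walk whatever `pos` is; after it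
the walk continues from `s'`. -/
lemma stackSum_append (n : ℕ) : ∀ s s' : List Bool, stackSum pos n (s ++ s') =
    ∑ k ∈ Finset.range (n + 1), stackSum True k s * stackSum pos (n - k) s' := by
  induction n with
  | zero =>
    intro s s'
    cases s <;> simp [stackSum]
  | succ n ih =>
    intro s s'
    rw [Finset.sum_range_succ']
    cases s with
    | nil => simp [stackSum]
    | cons b s =>
      have h1 := ih (true :: b :: s) s'
      have h2 := ih ((!b) :: s) s'
      have h3 := ih s s'
      simp only [List.cons_append] at h1 h2
      simp only [List.cons_append, stackSum, h1, h2, h3, Nat.add_sub_add_right, add_mul,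
        Finset.sum_add_distrib, Finset.mul_sum, mul_assoc]
      simp

/-- Every step of nonzero weight changes the number of `true` cells by exactly one: a push adds one,
a switch adds or removes one, and only a `true` cell can be popped. A walk ending at the empty stack
thus has the parity of the initial count. -/
lemma stackSum_eq_zero (n : ℕ) : ∀ s : List Bool, Odd (n + s.count true) →
    stackSum pos n s = 0 := by
  induction n with
  | zero =>
    intro s hs
    cases s with
    | nil => simp at hs
    | cons b s => simp [stackSum]
  | succ n ih =>
    intro s hs
    cases s with
    | nil =>
      simp only [stackSum]
      rw [ih [true] (by simpa using hs), ite_self]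
    | cons b s =>
      have h1 := ih (true :: b :: s)
      have h2 := ih ((!b) :: s)
      have h3 := ih s
      simp only [stackSum]
      cases b
      · simp at *
        rw [h1 (by grind), h2 (by grind)]
        simp
      · simp at *
        rw [h1 (by grind), h2 (by grind), h3 (by grind)]
        simp

lemma sum_range_odd {M : Type*} [AddCommMonoid M] (n : ℕ) (F : ℕ → M)
    (h : ∀ k, Even k → F k = 0) :
    ∑ k ∈ Finset.range (2 * n + 1), F k = ∑ j ∈ Finset.Icc 1 n, F (2 * j - 1) := by
  induction n with
  | zero => simp [h 0 (by simp)]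
  | succ n ih =>
    rw [show 2 * (n + 1) + 1 = 2 * n + 1 + 1 + 1 by ring, Finset.sum_range_succ,
      Finset.sum_range_succ, ih, Finset.sum_Icc_succ_top (by omega), h (2 * n + 1 + 1) (by grind),
      add_zero]
    rfl

lemma stackSum_true_cons (n : ℕ) (s : List Bool) :
    stackSum pos (2 * n) (true :: s) = ∑ j ∈ Finset.Icc 1 n,
      stackSum True (2 * j - 1) [true] * stackSum pos (2 * n - (2 * j - 1)) s := by
  rw [← List.singleton_append, stackSum_append, sum_range_odd]
  intro k hk
  rw [stackSum_eq_zero True k [true] (by simp; grind), zero_mul]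

/-- The three terms are the pop, the switch and the push of the first step, the push being split at
the removal of the new cell. -/
lemma stackSum_true_recursion (n : ℕ) :
    stackSum pos (2 * n + 3) [true] = stackSum pos (2 * n + 2) [] +
      stackSum pos (2 * n + 2) [false] + ∑ k ∈ Finset.Icc 1 (n + 1),
        stackSum True (2 * k - 1) [true] * stackSum pos (2 * n + 3 - 2 * k) [true] := by
  have h := stackSum_true_cons pos (n + 1) [true]
  rw [show 2 * (n + 1) = 2 * n + 2 by ring] at h
  have h' : stackSum pos (2 * n + 3) [true] = stackSum pos (2 * n + 2) [true, true] +
      1 * stackSum pos (2 * n + 2) [false] + 1 * stackSum pos (2 * n + 2) [] := by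
    conv_lhs => rw [stackSum]
    simp only [cellCoeff, Bool.not_true, if_true]
  rw [h', h, one_mul, one_mul]
  rw [add_comm, add_comm (∑ _ ∈ _, _), add_assoc]
  congr 2
  refine Finset.sum_congr rfl fun k hk => ?_
  rw [Finset.mem_Icc] at hk
  congr 2
  omega

lemma stackSum_false_recursion (n : ℕ) :
    stackSum pos (2 * n + 2) [false] = 1 / 2 * stackSum pos (2 * n + 1) [true] +
      ∑ k ∈ Finset.Icc 1 n,
        stackSum True (2 * k - 1) [true] * stackSum pos (2 * n + 2 - 2 * k) [false] := by
  have h : stackSum pos (2 * n + 1) [true, false] = ∑ k ∈ Finset.Icc 1 n,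
      stackSum True (2 * k - 1) [true] * stackSum pos (2 * n + 2 - 2 * k) [false] := by
    rw [← List.singleton_append, stackSum_append, Finset.sum_range_succ, sum_range_odd,
      Nat.sub_self]
    -- The summand with `k = 2 * n + 1` leaves no step for the lower cell and vanishes, so the sum
    -- stops at `n`.
    · simp only [stackSum, List.cons_ne_nil, if_false, mul_zero, add_zero]
      refine Finset.sum_congr rfl fun k hk => ?_
      rw [Finset.mem_Icc] at hk
      congr 2
      omega
    · intro k hk
      rw [stackSum_eq_zero True k [true] (by simp; grind), zero_mul]
  rw [stackSum, h]
  simp only [cellCoeff, Bool.not_false, Bool.false_eq_true, if_false, zero_mul, add_zero]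
  rw [add_comm]

end StackSum

/-! ### Recursions and initial values for the path sums -/

lemma tetilla_recursion (m : ℕ) (hm : 2 ≤ m) :
    pathSum tetillaKernel (2 * m) tetillaKernel =
        pathSum tetillaKernel (2 * m - 2) tetillaKernel +
        pathSum tetillaKernel (2 * m - 1) tetillaKernelContr +
        ∑ k ∈ Finset.Icc 1 (m - 1), positivePathSum tetillaKernel (2 * k) tetillaKernel *
          pathSum tetillaKernel (2 * m - 2 * k) tetillaKernel ∧
      pathSum tetillaKernel (2 * m - 1) tetillaKernelContr =
        1 / 2 * pathSum tetillaKernel (2 * m - 2) tetillaKernel +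
        ∑ k ∈ Finset.Icc 1 (m - 2), positivePathSum tetillaKernel (2 * k) tetillaKernel *
          pathSum tetillaKernel (2 * m - 2 * k - 1) tetillaKernelContr ∧
      positivePathSum tetillaKernel (2 * m) tetillaKernel =
        positivePathSum tetillaKernel (2 * m - 1) tetillaKernelContr +
        ∑ k ∈ Finset.Icc 1 (m - 1), positivePathSum tetillaKernel (2 * k) tetillaKernel *
          positivePathSum tetillaKernel (2 * m - 2 * k) tetillaKernel ∧
      positivePathSum tetillaKernel (2 * m - 1) tetillaKernelContr =
        1 / 2 * positivePathSum tetillaKernel (2 * m - 2) tetillaKernel +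
        ∑ k ∈ Finset.Icc 1 (m - 2), positivePathSum tetillaKernel (2 * k) tetillaKernel *
          positivePathSum tetillaKernel (2 * m - 2 * k - 1) tetillaKernelContr := by
  obtain ⟨n, rfl⟩ := Nat.exists_eq_add_of_le' hm
  have e1 : 2 * (n + 2) = (2 * n + 3) + 1 := by ring
  have e2 : 2 * (n + 2) - 1 = (2 * n + 2) + 1 := by omega
  have e3 : 2 * (n + 2) - 2 = (2 * n + 1) + 1 := by omega
  have hk (k : ℕ) (h : 1 ≤ k) : 2 * k = (2 * k - 1) + 1 := by omega
  have hk1 (k : ℕ) (h : k ≤ n + 1) : 2 * (n + 2) - 2 * k = (2 * n + 3 - 2 * k) + 1 := by omega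
  have hk2 (k : ℕ) (h : k ≤ n) : 2 * (n + 2) - 2 * k - 1 = (2 * n + 2 - 2 * k) + 1 := by omega
  have p1 (k : ℕ) (h : 1 ≤ k) : positivePathSum tetillaKernel (2 * k) tetillaKernel =
      stackSum True (2 * k - 1) [true] := by
    rw [← positivePathSum_tetillaKernel, ← hk k h]
  have p2 (k : ℕ) (h : k ≤ n + 1) :
      pathSum tetillaKernel (2 * (n + 2) - 2 * k) tetillaKernel =
        stackSum False (2 * n + 3 - 2 * k) [true] ∧
      positivePathSum tetillaKernel (2 * (n + 2) - 2 * k) tetillaKernel =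
        stackSum True (2 * n + 3 - 2 * k) [true] := by
    rw [hk1 k h]
    exact ⟨pathSum_tetillaKernel _, positivePathSum_tetillaKernel _⟩
  have p3 (k : ℕ) (h : k ≤ n) :
      pathSum tetillaKernel (2 * (n + 2) - 2 * k - 1) tetillaKernelContr =
        stackSum False (2 * n + 2 - 2 * k) [false] ∧
      positivePathSum tetillaKernel (2 * (n + 2) - 2 * k - 1) tetillaKernelContr =
        stackSum True (2 * n + 2 - 2 * k) [false] := by
    rw [hk2 k h]
    exact ⟨pathSum_tetillaKernelContr _, positivePathSum_tetillaKernelContr _⟩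
  have f1 := stackSum_true_recursion False n
  have f2 := stackSum_false_recursion False n
  have f3 := stackSum_true_recursion True n
  have f4 := stackSum_false_recursion True n
  -- From the empty stack the only move is a push, and it is forbidden for positive walks. This is
  -- why the unrestricted recursion has one more term than the positive one.
  have g1 : stackSum False (2 * n + 2) [] = stackSum False (2 * n + 1) [true] := by simp [stackSum]
  have g2 : stackSum True (2 * n + 2) [] = 0 := by simp [stackSum]
  rw [g1] at f1
  rw [g2, zero_add] at f3
  have q1 : pathSum tetillaKernel (2 * (n + 2)) tetillaKernel = stackSum False (2 * n + 3) [true] :=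
    e1 ▸ pathSum_tetillaKernel _
  have q2 : positivePathSum tetillaKernel (2 * (n + 2)) tetillaKernel =
      stackSum True (2 * n + 3) [true] := e1 ▸ positivePathSum_tetillaKernel _
  rw [q1, q2, e2, e3]
  simp only [pathSum_tetillaKernel, pathSum_tetillaKernelContr, positivePathSum_tetillaKernel,
    positivePathSum_tetillaKernelContr]
  refine ⟨f1.trans ?_, f2.trans ?_, f3.trans ?_, f4.trans ?_⟩ <;>
  · congr 1
    refine Finset.sum_congr rfl fun k h => ?_
    rw [Finset.mem_Icc] at h
    rw [p1 k h.1]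
    first
      | rw [(p2 k (by omega)).1]
      | rw [(p2 k (by omega)).2]
      | rw [(p3 k (by omega)).1]
      | rw [(p3 k (by omega)).2]

lemma tetilla_initial :
    pathSum tetillaKernel 2 tetillaKernel = 1 ∧
    pathSum tetillaKernel 3 tetillaKernelContr = 1 / 2 ∧
    positivePathSum tetillaKernel 2 tetillaKernel = 1 ∧
    positivePathSum tetillaKernel 3 tetillaKernelContr = 1 / 2 := by
  rw [pathSum_tetillaKernel, pathSum_tetillaKernelContr, positivePathSum_tetillaKernel,
    positivePathSum_tetillaKernelContr]
  simp [stackSum, cellCoeff]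

/-! ### Semicircular moments -/

/-- Substitution `u = 2 √t cos θ`: the density and the Jacobian each contribute a factor `sin θ`,
and the sign of the derivative is absorbed by reversing the endpoints. -/
lemma integral_semicircular (t : ℝ≥0) (ht : t ≠ 0) (g : ℝ → ℝ) (hg : Continuous g) :
    ∫ u, g u ∂(semicircular t) =
      2 / Real.pi * ∫ θ in (0 : ℝ)..Real.pi, g (2 * √(t : ℝ) * Real.cos θ) * Real.sin θ ^ 2 := by
  have htp : (0 : ℝ) < t := by positivity
  have hs : 0 < √(t : ℝ) := Real.sqrt_pos.2 htp
  have hst : √(t : ℝ) ^ 2 = t := Real.sq_sqrt htp.le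
  set w : ℝ → ℝ := fun u => 1 / (2 * Real.pi * t) * √(4 * t - u ^ 2) with hw
  have hwc : Continuous w := by fun_prop
  have hmeas : Measurable fun u => (Set.Ioo (-2 * √(t : ℝ)) (2 * √(t : ℝ))).indicator w u :=
    hwc.measurable.indicator measurableSet_Ioo
  have hw0 (u : ℝ) : 0 ≤ w u := by positivity
  rw [semicircular, if_neg ht, integral_withDensity_eq_integral_toReal_smul
    hmeas.ennreal_ofReal (ae_of_all _ fun _ => ENNReal.ofReal_lt_top)]
  have h1 : ∀ u, (ENNReal.ofReal ((Set.Ioo (-2 * √(t : ℝ)) (2 * √(t : ℝ))).indicator w u)).toReal •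
      g u = (Set.Ioo (-2 * √(t : ℝ)) (2 * √(t : ℝ))).indicator (fun u => w u * g u) u := by
    intro u
    rw [ENNReal.toReal_ofReal (Set.indicator_nonneg (fun u _ => hw0 u) u), smul_eq_mul]
    by_cases hu : u ∈ Set.Ioo (-2 * √(t : ℝ)) (2 * √(t : ℝ))
    · rw [Set.indicator_of_mem hu, Set.indicator_of_mem hu]
    · rw [Set.indicator_of_notMem hu, Set.indicator_of_notMem hu, zero_mul]
  simp only [h1]
  rw [integral_indicator measurableSet_Ioo, ← integral_Ioc_eq_integral_Ioo,
    ← intervalIntegral.integral_of_le (by linarith)]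
  have h2 := intervalIntegral.integral_comp_mul_deriv (a := 0) (b := Real.pi)
    (f := fun θ => 2 * √(t : ℝ) * Real.cos θ) (f' := fun θ => 2 * √(t : ℝ) * (-Real.sin θ))
    (g := fun u => w u * g u) (fun θ _ => (Real.hasDerivAt_cos θ).const_mul _)
    (by fun_prop) (by fun_prop)
  simp only [Real.cos_zero, Real.cos_pi, mul_one, Function.comp_def] at h2
  rw [intervalIntegral.integral_symm, show -2 * √(t : ℝ) = 2 * √(t : ℝ) * -1 by ring, ← h2,
    ← intervalIntegral.integral_neg, ← intervalIntegral.integral_const_mul]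
  refine intervalIntegral.integral_congr fun θ hθ => ?_
  rw [Set.uIcc_of_le Real.pi_pos.le] at hθ
  have hsin := Real.sin_nonneg_of_mem_Icc hθ
  have h3 : √(4 * (t : ℝ) - (2 * √(t : ℝ) * Real.cos θ) ^ 2) = 2 * √(t : ℝ) * Real.sin θ := by
    rw [show 4 * (t : ℝ) - (2 * √(t : ℝ) * Real.cos θ) ^ 2 = (2 * √(t : ℝ) * Real.sin θ) ^ 2 by
      rw [mul_pow, mul_pow, mul_pow, mul_pow, hst, Real.sin_sq]; ring,
      Real.sqrt_sq (mul_nonneg (by positivity) hsin)]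
  simp only [hw, h3]
  have hpi := Real.pi_ne_zero
  field_simp
  rw [hst]

lemma integral_sin_mul_sin (n : ℕ) (hn : n ≠ 0) :
    ∫ θ in (0 : ℝ)..Real.pi, Real.sin ((n + 1) * θ) * Real.sin θ = 0 := by
  have hn' : (n : ℝ) ≠ 0 := by positivity
  have hn2 : (n : ℝ) + 2 ≠ 0 := by positivity
  have h (c : ℝ) (k : ℕ) (hc : c = k) (hc0 : c ≠ 0) :
      ∫ θ in (0 : ℝ)..Real.pi, Real.cos (c * θ) = 0 := by
    rw [intervalIntegral.integral_comp_mul_left (fun x => Real.cos x) hc0, integral_cos, hc,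
      Real.sin_nat_mul_pi]
    simp
  calc _ = ∫ θ in (0 : ℝ)..Real.pi,
        (1 / 2) * Real.cos (n * θ) - (1 / 2) * Real.cos ((n + 2) * θ) := by
        refine intervalIntegral.integral_congr fun θ _ => ?_
        have e1 : (n : ℝ) * θ = (n + 1) * θ - θ := by ring
        have e2 : ((n : ℝ) + 2) * θ = (n + 1) * θ + θ := by ring
        simp only [e1, e2, Real.cos_sub, Real.cos_add]
        ring
    _ = 0 := by
        rw [intervalIntegral.integral_sub, intervalIntegral.integral_const_mul,
          intervalIntegral.integral_const_mul, h n n rfl hn', h (n + 2) (n + 2) (by simp) hn2]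
        · simp
        all_goals exact Continuous.intervalIntegrable (by fun_prop) _ _

/-- The Chebyshev polynomials of the second kind are orthogonal to `1` for the semicircular law of
variance one. -/
lemma integral_chebyshev_semicircular (n : ℕ) (hn : n ≠ 0) :
    ∫ u, (Polynomial.Chebyshev.S ℝ n).eval u ∂(semicircular 1) = 0 := by
  rw [integral_semicircular 1 one_ne_zero _ (by fun_prop)]
  refine mul_eq_zero_of_right _ (Eq.trans ?_ (integral_sin_mul_sin n hn))
  refine intervalIntegral.integral_congr fun θ _ => ?_
  have := Polynomial.Chebyshev.S_two_mul_real_cos θ n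
  simp only [NNReal.coe_one, Real.sqrt_one, mul_one, sq, ← mul_assoc, this, Int.cast_natCast]

lemma integral_pow_semicircular (t : ℝ≥0) (n : ℕ) (hn : n ≠ 0) :
    ∫ u, u ^ n ∂(semicircular t) =
      2 / Real.pi * (2 * √(t : ℝ)) ^ n *
        ∫ θ in (0 : ℝ)..Real.pi, Real.cos θ ^ n * Real.sin θ ^ 2 := by
  by_cases ht : t = 0
  · subst ht
    simp [semicircular, hn]
  · rw [integral_semicircular t ht _ (by fun_prop), mul_assoc,
      ← intervalIntegral.integral_const_mul ((2 * √(t : ℝ)) ^ n)]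
    simp only [mul_pow, mul_assoc]

lemma integral_id_semicircular (t : ℝ≥0) : ∫ u, u ∂(semicircular t) = 0 := by
  have := integral_pow_semicircular t 1 one_ne_zero
  simp only [pow_one] at this
  rw [this]
  have h := integral_sin_pow_mul_cos_pow_odd (a := 0) (b := Real.pi) 2 0
  simp only [mul_zero, zero_add, pow_one, pow_zero, mul_one, Real.sin_zero, Real.sin_pi,
    intervalIntegral.integral_same] at h
  simp only [mul_comm (Real.cos _), h, mul_zero]

lemma integral_sq_semicircular (t : ℝ≥0) : ∫ u, u ^ 2 ∂(semicircular t) = t := by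
  have h : ∫ θ in (0 : ℝ)..Real.pi, Real.cos θ ^ 2 * Real.sin θ ^ 2 = Real.pi / 8 := by
    simp only [mul_comm (Real.cos _ ^ 2)]
    rw [integral_sin_sq_mul_cos_sq]
    have : Real.sin (4 * Real.pi) = 0 := by simpa using Real.sin_nat_mul_pi 4
    simp [this]
  rw [integral_pow_semicircular t 2 two_ne_zero, h, mul_pow, Real.sq_sqrt t.coe_nonneg]
  have hpi := Real.pi_ne_zero
  field_simp
  ring

lemma integral_pow_four_semicircular (t : ℝ≥0) : ∫ u, u ^ 4 ∂(semicircular t) = 2 * (t : ℝ) ^ 2 := by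
  have h : ∫ θ in (0 : ℝ)..Real.pi, Real.cos θ ^ 4 * Real.sin θ ^ 2 = Real.pi / 16 := by
    have h4 := integral_cos_pow (a := 0) (b := Real.pi) 4
    have h2 := integral_cos_pow (a := 0) (b := Real.pi) 2
    have h0 := integral_cos_pow (a := 0) (b := Real.pi) 0
    norm_num at h0 h2 h4
    have : ∀ θ, Real.cos θ ^ 4 * Real.sin θ ^ 2 = Real.cos θ ^ 4 - Real.cos θ ^ 6 := by
      intro θ
      rw [Real.sin_sq]; ring
    simp only [this]
    rw [intervalIntegral.integral_sub, h4, h2]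
    · ring
    all_goals exact Continuous.intervalIntegrable (by fun_prop) _ _
  rw [integral_pow_semicircular t 4 (by norm_num), h, mul_pow,
    show √(t : ℝ) ^ 4 = (√(t : ℝ) ^ 2) ^ 2 by ring, Real.sq_sqrt t.coe_nonneg]
  have hpi := Real.pi_ne_zero
  field_simp
  ring

/-! ### Expectations of polynomials in one variable -/

section Distribution

variable {R : Type u} [Ring R] [StarRing R] [Algebra ℂ R]

lemma HasDistribution.aeval {E : R →ₗ[ℂ] ℂ} {x : R} {μ : Measure ℝ} (h : HasDistribution E x μ)
    (p : Polynomial ℝ) :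
    E (Polynomial.aeval x (p.map (algebraMap ℝ ℂ))) = ((∫ t, p.eval t ∂μ : ℝ) : ℂ) := by
  have hint (q : Polynomial ℝ) : Integrable (fun t => q.eval t) μ := by
    simp only [Polynomial.eval_eq_sum_range]
    exact integrable_finsetSum _ fun i _ => (h.integrable i).const_mul _
  induction p using Polynomial.induction_on' with
  | add p q hp hq =>
    rw [Polynomial.map_add, map_add, map_add, hp, hq]
    simp only [Polynomial.eval_add]
    rw [integral_add (hint p) (hint q)]
    push_cast; rfl
  | monomial n a =>
    rw [Polynomial.map_monomial, Polynomial.aeval_monomial, ← Algebra.smul_def, map_smul,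
      h.moment n]
    simp only [Polynomial.eval_monomial, integral_const_mul]
    push_cast; rfl

lemma HasDistribution.aeval_chebyshev {E : R →ₗ[ℂ] ℂ} {x : R}
    (h : HasDistribution E x (semicircular 1)) (n : ℕ) (hn : n ≠ 0) :
    E (Polynomial.aeval x (Polynomial.Chebyshev.S ℂ n)) = 0 := by
  have := h.aeval (Polynomial.Chebyshev.S ℝ n)
  rw [integral_chebyshev_semicircular n hn, Polynomial.Chebyshev.map_S] at this
  simpa using this

end Distribution

/-! ### Words in free semicircular elements -/

section Words

variable {R : Type u} [Ring R] {ι : Type}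

/-- The word with the given runs. -/
def ofRuns (l : List (ι × ℕ)) : List ι := l.flatMap fun p => List.replicate (p.2 + 1) p.1

lemma head?_ofRuns (l : List (ι × ℕ)) : (ofRuns l).head? = l.head?.map Prod.fst := by
  cases l <;> simp [ofRuns, List.replicate_succ]

variable [DecidableEq ι]

/-- The orthogonal polynomial in the letters `a i` attached to a word, whose head is the rightmost
letter. -/
def wordElem (a : ι → R) : List ι → R
  | [] => 1
  | [i] => a i
  | i :: j :: w => wordElem a (j :: w) * a i - if i = j then wordElem a w else 0

lemma wordElem_cons_of_ne (a : ι → R) (i : ι) (w : List ι) (h : w.head? ≠ some i) :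
    wordElem a (i :: w) = wordElem a w * a i := by
  cases w with
  | nil => simp [wordElem]
  | cons j w =>
    have : ¬ i = j := fun e => h (by simp [e])
    simp [wordElem, this]

variable [Algebra ℂ R]

/-- On a run of equal letters the recursion of `wordElem` is the three-term recurrence of the
rescaled Chebyshev polynomials. -/
lemma wordElem_replicate (a : ι → R) (i : ι) (w : List ι) (h : w.head? ≠ some i) (n : ℕ) :
    wordElem a (List.replicate n i ++ w) =
      wordElem a w * Polynomial.aeval (a i) (Polynomial.Chebyshev.S ℂ n) := by
  induction n using Nat.twoStepInduction with
  | zero => simp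
  | one => simp [wordElem_cons_of_ne a i w h]
  | more n h0 h1 =>
    rw [List.replicate_succ, List.cons_append] at h1
    rw [List.replicate_succ, List.replicate_succ, List.cons_append, List.cons_append, wordElem,
      if_pos rfl, h0, h1]
    have := Polynomial.Chebyshev.S_add_two ℂ (n : ℤ)
    push_cast
    rw [this, mul_comm Polynomial.X]
    simp only [map_sub, map_mul, Polynomial.aeval_X, mul_sub, mul_assoc]

lemma exists_ofRuns (w : List ι) :
    ∃ l : List (ι × ℕ), l.IsChain (fun p q => p.1 ≠ q.1) ∧ ofRuns l = w := by
  induction w with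
  | nil => exact ⟨[], by simp, rfl⟩
  | cons i w ih =>
    obtain ⟨l, hl, rfl⟩ := ih
    cases l with
    | nil => exact ⟨[(i, 0)], by simp, rfl⟩
    | cons p l =>
      obtain ⟨j, n⟩ := p
      by_cases hij : i = j
      · subst hij
        refine ⟨(i, n + 1) :: l, ?_, ?_⟩
        · cases l with
          | nil => simp
          | cons q l =>
            rw [List.isChain_cons_cons] at hl ⊢
            exact hl
        · simp [ofRuns, List.replicate_succ]
      · refine ⟨(i, 0) :: (j, n) :: l, ?_, rfl⟩
        rw [List.isChain_cons_cons]
        exact ⟨hij, hl⟩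

/-- The Chebyshev polynomial of degree `n + 1` in the letter `a i`. -/
def chebElem (a : ι → R) (p : ι × ℕ) : R :=
  Polynomial.aeval (a p.1) (Polynomial.Chebyshev.S ℂ (p.2 + 1 : ℕ))

lemma wordElem_ofRuns (a : ι → R) (l : List (ι × ℕ))
    (hl : l.IsChain (fun p q => p.1 ≠ q.1)) :
    wordElem a (ofRuns l) = (l.reverse.map (chebElem a)).prod := by
  induction l with
  | nil => rfl
  | cons p l ih =>
    have hl' := List.IsChain.tail hl
    have hh : (ofRuns l).head? ≠ some p.1 := by
      rw [head?_ofRuns]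
      cases l with
      | nil => simp
      | cons q l =>
        rw [List.isChain_cons_cons] at hl
        simpa using hl.1.symm
    have : ofRuns (p :: l) = List.replicate (p.2 + 1) p.1 ++ ofRuns l := by simp [ofRuns]
    rw [this, wordElem_replicate a p.1 _ hh, ih hl']
    simp [chebElem]

/-- Cut into maximal runs, the word becomes an alternating product of Chebyshev polynomials of
positive degree. Each factor is centered for the semicircular law, so the definition of freeness
applies. -/
lemma apply_wordElem [StarRing R] {E : R →ₗ[ℂ] ℂ} {B : ι → Subalgebra ℂ R}
    (hB : FreelyIndependent E B) {a : ι → R} (ha : ∀ i, a i ∈ B i)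
    (hd : ∀ i, HasDistribution E (a i) (semicircular 1)) (w : List ι) (hw : w ≠ []) :
    E (wordElem a w) = 0 := by
  obtain ⟨l, hl, rfl⟩ := exists_ofRuns w
  rw [wordElem_ofRuns a l hl]
  have hne : l.reverse ≠ [] := by
    rintro h
    rw [List.reverse_eq_nil_iff] at h
    exact hw (by rw [h]; rfl)
  have hc : l.reverse.IsChain (fun p q => p.1 ≠ q.1) := by
    rw [List.isChain_reverse]
    exact hl.imp fun p q h => h.symm
  generalize l.reverse = L at hne hc
  obtain ⟨n, v, rfl⟩ : ∃ (n : ℕ) (v : Fin (n + 1) → ι × ℕ), L = List.ofFn v := by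
    cases L with
    | nil => exact absurd rfl hne
    | cons p L => exact ⟨L.length, (p :: L).get, (List.ofFn_get _).symm⟩
  rw [List.map_ofFn]
  refine hB n (fun j => (v j).1) _ (fun j => ?_) (fun j => ?_) fun j => ?_
  · exact Algebra.adjoin_le (Set.singleton_subset_iff.2 (ha _))
      (Polynomial.aeval_mem_adjoin_singleton _ _)
  · rw [List.isChain_ofFn] at hc
    exact hc j (by omega)
  · exact (hd _).aeval_chebyshev _ (by simp)

end Words

/-! ### Moments of the tetilla law -/

section Tetilla

variable {R : Type u} [Ring R] [Algebra ℂ R]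

/-- The constant `1 / √2`. -/
def invSqrtTwo : ℂ := ((√2 : ℝ) : ℂ)⁻¹

lemma invSqrtTwo_mul_self : invSqrtTwo * invSqrtTwo = 1 / 2 := by
  rw [invSqrtTwo, ← mul_inv, ← Complex.ofReal_mul, Real.mul_self_sqrt zero_le_two]
  norm_num

lemma tetilla_eq (x y : R) : tetilla x y = invSqrtTwo • (x * y + y * x) := rfl

/-- The element represented by a stack, on top of which the letters of a word are put. -/
def stackElem (a : Fin 2 → R) : List Bool → List (Fin 2) → R
  | [], w => wordElem a w
  | true :: s, w => invSqrtTwo • (stackElem a s (w ++ [0, 1]) + stackElem a s (w ++ [1, 0]))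
  | false :: s, w => (1 / 2 : ℂ) • (stackElem a s (w ++ [0, 0]) + stackElem a s (w ++ [1, 1]))

/-- Unfolding the stack only appends letters at the far end of the word, so the recursion at its
head survives linearly. -/
lemma stackElem_cons_cons (a : Fin 2 → R) (s : List Bool) : ∀ (i j : Fin 2) (w : List (Fin 2)),
    stackElem a s (i :: j :: w) =
      stackElem a s (j :: w) * a i - if i = j then stackElem a s w else 0 := by
  induction s with
  | nil => intro i j w; rfl
  | cons b s ih =>
    intro i j w
    cases b <;>
    · simp only [stackElem, List.cons_append, ih]
      split_ifs
      · simp only [smul_mul_assoc, smul_add, smul_sub, add_mul]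
        abel
      · simp only [smul_mul_assoc, smul_add, add_mul, sub_zero]

/-- This is the product formula for Wigner integrals in letters: the new pair of letters is
cancelled against the top cell zero times, once or twice. -/
lemma stackElem_true_mul_tetilla (a : Fin 2 → R) (s : List Bool) :
    stackElem a (true :: s) [] * tetilla (a 0) (a 1) =
      stackElem a (true :: true :: s) [] + stackElem a (false :: s) [] + stackElem a s [] := by
  have h01 : ((0 : Fin 2) = 1) = False := by simp
  have h10 : ((1 : Fin 2) = 0) = False := by simp
  simp only [stackElem, List.nil_append, List.cons_append, stackElem_cons_cons, h01, h10, if_true,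
    if_false, sub_zero, tetilla_eq]
  simp only [mul_add, add_mul, sub_mul, smul_mul_assoc, mul_smul_comm, mul_assoc, smul_add,
    smul_sub, smul_smul, invSqrtTwo_mul_self]
  module

/-- No term removes the cell: its two letters are equal while those of the tetilla element differ,
so at most one pair cancels. -/
lemma stackElem_false_mul_tetilla (a : Fin 2 → R) (s : List Bool) :
    stackElem a (false :: s) [] * tetilla (a 0) (a 1) =
      stackElem a (true :: false :: s) [] + (1 / 2 : ℂ) • stackElem a (true :: s) [] := by
  have h01 : ((0 : Fin 2) = 1) = False := by simp
  have h10 : ((1 : Fin 2) = 0) = False := by simp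
  simp only [stackElem, List.nil_append, List.cons_append, stackElem_cons_cons, h01, h10, if_true,
    if_false, sub_zero, tetilla_eq]
  simp only [mul_add, add_mul, sub_mul, smul_mul_assoc, mul_smul_comm, mul_assoc, smul_add,
    smul_sub, smul_smul]
  module

lemma apply_stackElem_mul_tetilla_pow [StarRing R] {E : R →ₗ[ℂ] ℂ} (hE : E 1 = 1)
    {B : Fin 2 → Subalgebra ℂ R}
    (hB : FreelyIndependent E B) {a : Fin 2 → R} (ha : ∀ i, a i ∈ B i)
    (hd : ∀ i, HasDistribution E (a i) (semicircular 1)) (n : ℕ) : ∀ s : List Bool,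
    E (stackElem a s [] * tetilla (a 0) (a 1) ^ n) = (stackSum False n s : ℂ) := by
  -- A nonempty stack expands into nonempty words only; this matches the terminal condition of
  -- `stackSum`.
  have h0 (s : List Bool) : ∀ w : List (Fin 2), s ≠ [] ∨ w ≠ [] → E (stackElem a s w) = 0 := by
    induction s with
    | nil =>
      intro w hw
      exact apply_wordElem hB ha hd w (by simpa using hw)
    | cons b s ih =>
      intro w _
      cases b <;> simp only [stackElem, map_smul, map_add] <;>
        rw [ih _ (by simp), ih _ (by simp)] <;> simp
  induction n with
  | zero =>
    intro s
    rw [pow_zero, mul_one]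
    cases s with
    | nil => simp [stackElem, wordElem, stackSum, hE]
    | cons b s => rw [h0 _ _ (by simp)]; simp [stackSum]
  | succ n ih =>
    intro s
    rw [pow_succ', ← mul_assoc]
    match s with
    | [] =>
      have : stackElem a [] [] * tetilla (a 0) (a 1) = stackElem a [true] [] := by
        simp [stackElem, wordElem, tetilla, invSqrtTwo, add_comm]
      rw [this, ih]
      simp [stackSum]
    | true :: s =>
      rw [stackElem_true_mul_tetilla, add_mul, add_mul, map_add, map_add, ih, ih, ih]
      simp [stackSum, cellCoeff]
    | false :: s =>
      rw [stackElem_false_mul_tetilla, add_mul, smul_mul_assoc, map_add, map_smul, ih, ih]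
      simp [stackSum, cellCoeff]

/-- Starting from the empty stack, the first of the `2 * m` steps is forced and produces `f`.
General subalgebras `B` and `C` are allowed so that the lemma also covers an increment and the past
algebra. -/
lemma apply_tetilla_pow [StarRing R] {E : R →ₗ[ℂ] ℂ} (hE : E 1 = 1) {x y : R}
    (hx : HasDistribution E x (semicircular 1)) (hy : HasDistribution E y (semicircular 1))
    {B C : Subalgebra ℂ R} (hB : FreelyIndependent E ![B, C]) (hxB : x ∈ B) (hyC : y ∈ C)
    (m : ℕ) (hm : 1 ≤ m) :
    E (tetilla x y ^ (2 * m)) = (pathSum tetillaKernel (2 * m) tetillaKernel : ℂ) := by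
  have := apply_stackElem_mul_tetilla_pow hE hB (a := ![x, y])
    (Fin.forall_fin_two.2 ⟨hxB, hyC⟩) (Fin.forall_fin_two.2 ⟨hx, hy⟩) (2 * m) []
  simp only [stackElem, wordElem, one_mul, Matrix.cons_val_zero, Matrix.cons_val_one] at this
  obtain ⟨k, hk⟩ : ∃ k, 2 * m = k + 1 := ⟨2 * m - 1, by omega⟩
  rw [this, hk, pathSum_tetillaKernel]
  simp [stackSum]

end Tetilla

/-! ### Mixed moments of order four of the free Brownian motion -/

section Free

variable {R : Type u} [Ring R] [Algebra ℂ R] {E : R →ₗ[ℂ] ℂ} {B C : Subalgebra ℂ R}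

lemma map_centered (hE : E 1 = 1) (x : R) : E (x - E x • (1 : R)) = 0 := by
  rw [map_sub, map_smul, hE, smul_eq_mul, mul_one, sub_self]

lemma sub_smul_one_mem (D : Subalgebra ℂ R) {x : R} (hx : x ∈ D) (z : ℂ) :
    x - z • (1 : R) ∈ D :=
  D.sub_mem hx (D.smul_mem D.one_mem z)

lemma FreelyIndependent.map_mul (h : FreelyIndependent E ![B, C]) (hE : E 1 = 1) {b c : R}
    (hb : b ∈ B) (hc : c ∈ C) : E (b * c) = E b * E c := by
  have key := h 1 ![0, 1] ![b - E b • (1 : R), c - E c • (1 : R)]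
    (by
      rw [Fin.forall_fin_two]
      exact ⟨sub_smul_one_mem B hb _, sub_smul_one_mem C hc _⟩)
    (by intro j; fin_cases j; simp)
    (by
      rw [Fin.forall_fin_two]
      exact ⟨map_centered hE b, map_centered hE c⟩)
  simp only [List.ofFn_succ, List.ofFn_zero, List.prod_cons, List.prod_nil, mul_one,
    Matrix.cons_val_zero, Matrix.cons_val_succ, sub_mul, mul_sub, smul_mul_assoc, one_mul,
    mul_smul_comm, map_sub, map_smul, hE, smul_eq_mul] at key
  linear_combination key

lemma FreelyIndependent.map_mul_four (h : FreelyIndependent E ![B, C]) {b b' c c' : R}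
    (hb : b ∈ B) (hc : c ∈ C) (hb' : b' ∈ B) (hc' : c' ∈ C) (eb : E b = 0) (ec : E c = 0)
    (eb' : E b' = 0) (ec' : E c' = 0) : E (b * c * b' * c') = 0 := by
  have key := h 3 ![0, 1, 0, 1] ![b, c, b', c']
    (by
      simp only [Fin.forall_fin_succ, IsEmpty.forall_iff, and_true]
      exact ⟨hb, hc, hb', hc'⟩)
    (by intro j; fin_cases j <;> simp)
    (by
      simp only [Fin.forall_fin_succ, IsEmpty.forall_iff, and_true]
      exact ⟨eb, ec, eb', ec'⟩)
  simpa [List.ofFn_succ, mul_assoc] using key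

end Free

section FourPoint

variable {R : Type u} [Ring R] [Algebra ℂ R]

/-- The properties of the free Brownian motion that determine its mixed moments of order four:
the increment after time `s` is centered, with variance `t - s`, and free from the past `C s`. -/
structure HasFreeIncrements (E : R →ₗ[ℂ] ℂ) (S : ℝ≥0 → R) (C : ℝ≥0 → Subalgebra ℂ R) : Prop where
  tracial : ∀ x y, E (x * y) = E (y * x)
  mem : ∀ s t, s ≤ t → S s ∈ C t
  map_self : ∀ t, E (S t) = 0
  map_sq : ∀ t, E (S t * S t) = ((t : ℝ) : ℂ)
  map_four : ∀ t, E (S t * S t * S t * S t) = 2 * ((t : ℝ) : ℂ) ^ 2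
  one : ∀ s t, s < t → ∀ c ∈ C s, E ((S t - S s) * c) = 0
  two : ∀ s t, s < t → ∀ c ∈ C s,
    E ((S t - S s) * (S t - S s) * c) = (((t : ℝ) - (s : ℝ) : ℝ) : ℂ) * E c
  three : ∀ s t, s < t → ∀ c ∈ C s, E c = 0 →
    E ((S t - S s) * (S t - S s) * (S t - S s) * c) = 0
  alternating : ∀ s t, s < t → ∀ c ∈ C s, ∀ d ∈ C s, E c = 0 → E d = 0 →
    E ((S t - S s) * c * (S t - S s) * d) = 0

namespace HasFreeIncrements

variable {E : R →ₗ[ℂ] ℂ} {S : ℝ≥0 → R} {C : ℝ≥0 → Subalgebra ℂ R} (h : HasFreeIncrements E S C)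

include h

lemma map_mul_of_le {a b : ℝ≥0} (hab : a ≤ b) : E (S a * S b) = ((a : ℝ) : ℂ) := by
  rcases hab.eq_or_lt with rfl | hlt
  · exact h.map_sq a
  · have := h.one a b hlt _ (h.mem a a le_rfl)
    rw [h.tracial, mul_sub, map_sub, sub_eq_zero] at this
    rw [this, h.map_sq]

lemma map_mul (a b : ℝ≥0) : E (S a * S b) = ((min (a : ℝ) b : ℝ) : ℂ) := by
  rcases le_total a b with hab | hab
  · rw [h.map_mul_of_le hab, min_eq_left (by exact_mod_cast hab)]
  · rw [h.tracial, h.map_mul_of_le hab, min_eq_right (by exact_mod_cast hab)]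

lemma cyclic (a b c d : R) : E (a * b * c * d) = E (b * c * d * a) := by
  rw [mul_assoc, mul_assoc, h.tracial]
  simp only [mul_assoc]

/-- The replacement lemmas lower the largest time `t` to `s` by writing `S t = (S t - S s) + S s`.
Terms with one or three increments vanish, as do two increments separated by centered factors; two
neighbouring increments contribute `t - s` times the moment of the rest. -/
lemma replace_one {s t b c d : ℝ≥0} (hst : s ≤ t) (hb : b ≤ s) (hc : c ≤ s) (hd : d ≤ s) :
    E (S t * S b * S c * S d) = E (S s * S b * S c * S d) := by
  rcases hst.eq_or_lt with rfl | hlt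
  · rfl
  · have := h.one s t hlt (S b * S c * S d) ((C s).mul_mem ((C s).mul_mem (h.mem _ _ hb)
      (h.mem _ _ hc)) (h.mem _ _ hd))
    simp only [sub_mul, map_sub, ← mul_assoc] at this
    linear_combination this

lemma replace_adjacent {s t c d : ℝ≥0} (hst : s ≤ t) (hc : c ≤ s) (hd : d ≤ s) :
    E (S t * S t * S c * S d) =
      E (S s * S s * S c * S d) + (((t : ℝ) - (s : ℝ) : ℝ) : ℂ) * E (S c * S d) := by
  rcases hst.eq_or_lt with rfl | hlt
  · simp
  · have ms := h.mem s s le_rfl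
    have mc := h.mem _ _ hc
    have md := h.mem _ _ hd
    have h1 := h.one s t hlt (S s * S c * S d) ((C s).mul_mem ((C s).mul_mem ms mc) md)
    have h2 := h.one s t hlt (S c * S d * S s) ((C s).mul_mem ((C s).mul_mem mc md) ms)
    have h3 := h.two s t hlt (S c * S d) ((C s).mul_mem mc md)
    simp only [← mul_assoc] at h1 h2 h3
    rw [← h.cyclic] at h2
    simp only [sub_mul, mul_sub, map_sub] at h1 h2 h3
    linear_combination h1 + h2 + h3

lemma replace_opposite {s t b d : ℝ≥0} (hst : s ≤ t) (hb : b ≤ s) (hd : d ≤ s) :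
    E (S t * S b * S t * S d) = E (S s * S b * S s * S d) := by
  rcases hst.eq_or_lt with rfl | hlt
  · rfl
  · have ms := h.mem s s le_rfl
    have mb := h.mem _ _ hb
    have md := h.mem _ _ hd
    have h1 := h.one s t hlt (S b * S s * S d) ((C s).mul_mem ((C s).mul_mem mb ms) md)
    have h2 := h.one s t hlt (S d * S s * S b) ((C s).mul_mem ((C s).mul_mem md ms) mb)
    have h3 := h.alternating s t hlt _ mb _ md (h.map_self b) (h.map_self d)
    simp only [← mul_assoc] at h1 h2 h3
    rw [h.cyclic, h.cyclic] at h2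
    simp only [sub_mul, mul_sub, map_sub] at h1 h2 h3
    linear_combination h1 + h2 + h3

lemma replace_three {s t d : ℝ≥0} (hst : s ≤ t) (hd : d ≤ s) :
    E (S t * S t * S t * S d) = E (S s * S s * S s * S d) +
      2 * (((t : ℝ) - (s : ℝ) : ℝ) : ℂ) * E (S s * S d) := by
  rcases hst.eq_or_lt with rfl | hlt
  · simp
  · have ms := h.mem s s le_rfl
    have md := h.mem _ _ hd
    have h1 := h.one s t hlt (S s * S s * S d) ((C s).mul_mem ((C s).mul_mem ms ms) md)
    have h2 := h.one s t hlt (S s * S d * S s) ((C s).mul_mem ((C s).mul_mem ms md) ms)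
    have h3 := h.one s t hlt (S d * S s * S s) ((C s).mul_mem ((C s).mul_mem md ms) ms)
    have h4 := h.two s t hlt (S s * S d) ((C s).mul_mem ms md)
    have h5 := h.two s t hlt (S d * S s) ((C s).mul_mem md ms)
    have h6 := h.alternating s t hlt _ ms _ md (h.map_self s) (h.map_self d)
    have h7 := h.three s t hlt _ md (h.map_self d)
    simp only [← mul_assoc] at h1 h2 h3 h4 h5 h6 h7
    rw [← h.cyclic] at h2
    rw [h.cyclic, h.cyclic] at h3
    -- The two neighbouring pairs of increments give equal contributions by the trace property,
    -- whence the factor 2.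
    rw [← h.cyclic, h.tracial (S d)] at h5
    simp only [sub_mul, mul_sub, map_sub] at h1 h2 h3 h4 h5 h6 h7
    linear_combination h1 + h2 + h3 + h4 + h5 + h6 + h7

lemma map_three_of_le {t d : ℝ≥0} (hd : d ≤ t) :
    E (S t * S t * S t * S d) = 2 * ((t : ℝ) : ℂ) * ((d : ℝ) : ℂ) := by
  rw [h.replace_three hd le_rfl, h.map_four, h.map_sq]
  push_cast
  ring

lemma map_adjacent {t c d : ℝ≥0} (hc : c ≤ t) (hd : d ≤ t) :
    E (S t * S t * S c * S d) =
      (((t : ℝ) * min (c : ℝ) d + (d : ℝ) * c : ℝ) : ℂ) := by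
  rcases le_total d c with hdc | hdc
  · rw [h.replace_adjacent hc le_rfl hdc, h.map_three_of_le hdc, h.map_mul,
      min_eq_right (by exact_mod_cast hdc)]
    push_cast; ring
  · rw [h.replace_adjacent hd hdc le_rfl, ← h.cyclic, h.map_three_of_le hdc, h.map_mul,
      min_eq_left (by exact_mod_cast hdc)]
    push_cast; ring

lemma map_opposite {t b d : ℝ≥0} (hb : b ≤ t) (hd : d ≤ t) :
    E (S t * S b * S t * S d) = ((2 * (b : ℝ) * d : ℝ) : ℂ) := by
  rcases le_total d b with hdb | hdb
  · rw [h.replace_opposite hb le_rfl hdb, h.map_three_of_le hdb]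
    push_cast; ring
  · rw [h.replace_opposite hd hdb le_rfl, h.cyclic, h.cyclic, h.map_three_of_le hdb]
    push_cast; ring

/-- Lowering `a` to the second largest time makes that time occur twice, in adjacent or opposite
position, and reduces to `map_adjacent` or `map_opposite`. -/
lemma map_four_of_le {a b c d : ℝ≥0} (hb : b ≤ a) (hc : c ≤ a) (hd : d ≤ a) :
    E (S a * S b * S c * S d) =
      ((min (a : ℝ) b * min (c : ℝ) d + min (a : ℝ) d * min (b : ℝ) c : ℝ) : ℂ) := by
  have mab : min (a : ℝ) b = b := min_eq_right (by exact_mod_cast hb)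
  have mad : min (a : ℝ) d = d := min_eq_right (by exact_mod_cast hd)
  rw [mab, mad]
  rcases le_total c b with hcb | hcb <;> rcases le_total d b with hdb | hdb
  · rw [h.replace_one hb le_rfl hcb hdb, h.map_adjacent hcb hdb,
      min_eq_right (show (c : ℝ) ≤ b by exact_mod_cast hcb)]
  · rw [h.replace_one hd hdb (hcb.trans hdb) le_rfl, ← h.cyclic,
      h.map_adjacent hdb (hcb.trans hdb),
      min_eq_left (show (c : ℝ) ≤ d by exact_mod_cast hcb.trans hdb)]
    push_cast; ring
  · rw [h.replace_one hc hcb le_rfl (hdb.trans hcb), h.map_opposite hcb (hdb.trans hcb),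
      min_eq_right (show (d : ℝ) ≤ c by exact_mod_cast hdb.trans hcb),
      min_eq_left (show (b : ℝ) ≤ c by exact_mod_cast hcb)]
    push_cast; ring
  · rcases le_total d c with hdc | hdc
    · rw [h.replace_one hc hcb le_rfl hdc, h.map_opposite hcb hdc,
        min_eq_right (show (d : ℝ) ≤ c by exact_mod_cast hdc),
        min_eq_left (show (b : ℝ) ≤ c by exact_mod_cast hcb)]
      push_cast; ring
    · rw [h.replace_one hd hdb hdc le_rfl, ← h.cyclic, h.map_adjacent hdb hdc,
        min_eq_left (show (c : ℝ) ≤ d by exact_mod_cast hdc)]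
      push_cast; ring

/-- The noncrossing pairing formula for mixed moments of order four. -/
lemma map_mul_four (a b c d : ℝ≥0) :
    E (S a * S b * S c * S d) =
      ((min (a : ℝ) b * min (c : ℝ) d + min (a : ℝ) d * min (b : ℝ) c : ℝ) : ℂ) := by
  have hmax : (b ≤ a ∧ c ≤ a ∧ d ≤ a) ∨ (c ≤ b ∧ d ≤ b ∧ a ≤ b) ∨ (d ≤ c ∧ a ≤ c ∧ b ≤ c) ∨
      (a ≤ d ∧ b ≤ d ∧ c ≤ d) := by
    -- One of the four times is the largest; cyclic invariance of the trace brings it to the front.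
    grind
  rcases hmax with ⟨h1, h2, h3⟩ | ⟨h1, h2, h3⟩ | ⟨h1, h2, h3⟩ | ⟨h1, h2, h3⟩
  · exact h.map_four_of_le h1 h2 h3
  · rw [h.cyclic, h.map_four_of_le h1 h2 h3, min_comm (d : ℝ) a, min_comm (b : ℝ) a]
    push_cast; ring
  · rw [h.cyclic, h.cyclic, h.map_four_of_le h1 h2 h3, min_comm (c : ℝ) b, min_comm (d : ℝ) a]
    push_cast; ring
  · rw [← h.cyclic, h.map_four_of_le h1 h2 h3, min_comm (d : ℝ) a, min_comm (d : ℝ) c]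
    push_cast; ring

/-- The covariance of two increments. -/
def incrCov (a b a' b' : ℝ) : ℝ := min b b' - min b a' - min a b' + min a a'

lemma map_increments (a₁ b₁ a₂ b₂ a₃ b₃ a₄ b₄ : ℝ≥0) :
    E ((S b₁ - S a₁) * (S b₂ - S a₂) * (S b₃ - S a₃) * (S b₄ - S a₄)) =
      ((incrCov a₁ b₁ a₂ b₂ * incrCov a₃ b₃ a₄ b₄ +
        incrCov a₁ b₁ a₄ b₄ * incrCov a₂ b₂ a₃ b₃ : ℝ) : ℂ) := by
  simp only [sub_mul, mul_sub, map_sub, h.map_mul_four, incrCov]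
  push_cast
  ring

end HasFreeIncrements

end FourPoint

/-! ### The Wigner isometry in dimension two -/

lemma integral_indicator_Ioo_mul {a b a' b' : ℝ} (ha : 0 ≤ a) (hab : a < b) (hab' : a' < b') :
    ∫ s in Set.Ici (0 : ℝ), (Set.Ioo a b).indicator 1 s * (Set.Ioo a' b').indicator 1 s =
      HasFreeIncrements.incrCov a b a' b' := by
  have : (fun s : ℝ => (Set.Ioo a b).indicator (1 : ℝ → ℝ) s *
      (Set.Ioo a' b').indicator (1 : ℝ → ℝ) s) =
      (Set.Ioo a b ∩ Set.Ioo a' b').indicator 1 := by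
    funext s
    simp only [Set.inter_indicator_one, Pi.mul_apply]
  rw [this, integral_indicator_one (measurableSet_Ioo.inter measurableSet_Ioo), measureReal_def,
    Measure.restrict_apply (measurableSet_Ioo.inter measurableSet_Ioo),
    Set.inter_eq_left.2, Set.Ioo_inter_Ioo, Real.volume_Ioo, ENNReal.toReal_ofReal']
  · simp only [HasFreeIncrements.incrCov]
    grind
  · intro s hs
    exact ha.trans hs.1.1.le

lemma integrable_indicator_Ioo_mul (a b a' b' : ℝ) :
    Integrable (fun s : ℝ => (Set.Ioo a b).indicator (1 : ℝ → ℝ) s *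
      (Set.Ioo a' b').indicator (1 : ℝ → ℝ) s) (volume.restrict (Set.Ici (0 : ℝ))) := by
  have : (fun s : ℝ => (Set.Ioo a b).indicator (1 : ℝ → ℝ) s *
      (Set.Ioo a' b').indicator (1 : ℝ → ℝ) s) =
      (Set.Ioo a b ∩ Set.Ioo a' b').indicator 1 := by
    funext s
    simp only [Set.inter_indicator_one, Pi.mul_apply]
  rw [this]
  refine IntegrableOn.integrable_indicator ?_ (measurableSet_Ioo.inter measurableSet_Ioo)
  refine integrableOn_const ?_
  refine ne_of_lt (lt_of_le_of_lt (Measure.restrict_apply_le _ _) ?_)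
  exact lt_of_le_of_lt (measure_mono Set.inter_subset_left) measure_Ioo_lt_top

/-- The inner product of the indicators of two boxes. -/
def boxCov (Q Q' : Box 2) : ℝ :=
  HasFreeIncrements.incrCov (Q.a 0) (Q.b 0) (Q'.a 0) (Q'.b 0) *
    HasFreeIncrements.incrCov (Q.a 1) (Q.b 1) (Q'.a 1) (Q'.b 1)

lemma Box.kernel_mul_kernel (Q Q' : Box 2) (t : Fin 2 → ℝ) : Q.kernel t * Q'.kernel t =
    ((Set.Ioo (Q.a 0 : ℝ) (Q.b 0)).indicator 1 (t 0) *
      (Set.Ioo (Q'.a 0 : ℝ) (Q'.b 0)).indicator 1 (t 0)) *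
    ((Set.Ioo (Q.a 1 : ℝ) (Q.b 1)).indicator 1 (t 1) *
      (Set.Ioo (Q'.a 1 : ℝ) (Q'.b 1)).indicator 1 (t 1)) := by
  simp only [Box.kernel, Fin.prod_univ_two]
  ring

lemma Box.integrable_kernel_mul (Q Q' : Box 2) :
    Integrable (fun t => Q.kernel t * Q'.kernel t) (orthant 2) := by
  simp only [Box.kernel_mul_kernel]
  exact integrable_orthant_two_prod (integrable_indicator_Ioo_mul _ _ _ _)
    (integrable_indicator_Ioo_mul _ _ _ _)

lemma Box.integral_kernel_mul (Q Q' : Box 2) :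
    ∫ t, Q.kernel t * Q'.kernel t ∂(orthant 2) = boxCov Q Q' := by
  simp only [Box.kernel_mul_kernel]
  rw [integral_orthant_two_prod
    (fun x => (Set.Ioo (Q.a 0 : ℝ) (Q.b 0)).indicator 1 x *
      (Set.Ioo (Q'.a 0 : ℝ) (Q'.b 0)).indicator 1 x)
    (fun x => (Set.Ioo (Q.a 1 : ℝ) (Q.b 1)).indicator 1 x *
      (Set.Ioo (Q'.a 1 : ℝ) (Q'.b 1)).indicator 1 x),
    integral_indicator_Ioo_mul (Q.a 0).coe_nonneg (by exact_mod_cast Q.lt 0) (by exact_mod_cast Q'.lt 0),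
    integral_indicator_Ioo_mul (Q.a 1).coe_nonneg (by exact_mod_cast Q.lt 1) (by exact_mod_cast Q'.lt 1)]
  rfl

lemma Box.incrCov_eq_zero (Q : Box 2) :
    HasFreeIncrements.incrCov (Q.a 0) (Q.b 0) (Q.a 1) (Q.b 1) = 0 ∧
      HasFreeIncrements.incrCov (Q.a 1) (Q.b 1) (Q.a 0) (Q.b 0) = 0 := by
  have hd := Q.disjoint 0 1 (by simp)
  rw [Set.Ioo_disjoint_Ioo] at hd
  have h0 : (Q.a 0 : ℝ) < Q.b 0 := by exact_mod_cast Q.lt 0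
  have h1 : (Q.a 1 : ℝ) < Q.b 1 := by exact_mod_cast Q.lt 1
  have hd' : min (Q.b 0 : ℝ) (Q.b 1) ≤ max (Q.a 0 : ℝ) (Q.a 1) := by exact_mod_cast hd
  simp only [HasFreeIncrements.incrCov]
  generalize (Q.a 0 : ℝ) = a at *
  generalize (Q.b 0 : ℝ) = b at *
  generalize (Q.a 1 : ℝ) = a' at *
  generalize (Q.b 1 : ℝ) = b' at *
  clear hd
  constructor <;> grind

lemma simpleKernel_eq_sum {q : ℕ} (c : Box q →₀ ℝ) (t : Fin q → ℝ) :
    simpleKernel c t = ∑ Q ∈ c.support, c Q * Q.kernel t := rfl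

lemma simpleKernel_sq (c : Box 2 →₀ ℝ) (t : Fin 2 → ℝ) : simpleKernel c t ^ 2 =
    ∑ Q ∈ c.support, ∑ Q' ∈ c.support, c Q * c Q' * (Q.kernel t * Q'.kernel t) := by
  rw [sq, simpleKernel_eq_sum, Finset.sum_mul_sum]
  refine Finset.sum_congr rfl fun Q _ => Finset.sum_congr rfl fun Q' _ => ?_
  ring

lemma integrable_simpleKernel_sq (c : Box 2 →₀ ℝ) :
    Integrable (fun t => simpleKernel c t ^ 2) (orthant 2) := by
  simp only [simpleKernel_sq]
  exact integrable_finsetSum _ fun Q _ => integrable_finsetSum _ fun Q' _ =>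
    (Q.integrable_kernel_mul Q').const_mul _

lemma integral_simpleKernel_sq (c : Box 2 →₀ ℝ) :
    ∫ t, simpleKernel c t ^ 2 ∂(orthant 2) =
      ∑ Q ∈ c.support, ∑ Q' ∈ c.support, c Q * c Q' * boxCov Q Q' := by
  simp only [simpleKernel_sq]
  rw [integral_finsetSum _ fun Q _ => integrable_finsetSum _ fun Q' _ =>
    (Q.integrable_kernel_mul Q').const_mul _]
  refine Finset.sum_congr rfl fun Q _ => ?_
  rw [integral_finsetSum _ fun Q' _ => (Q.integrable_kernel_mul Q').const_mul _]
  simp only [integral_const_mul, Box.integral_kernel_mul]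

lemma measurable_simpleKernel {q : ℕ} (c : Box q →₀ ℝ) : Measurable (simpleKernel c) := by
  have : simpleKernel c = fun t => ∑ Q ∈ c.support, c Q * Q.kernel t := rfl
  rw [this]
  refine Finset.measurable_sum _ fun Q _ => Measurable.const_mul ?_ _
  refine Finset.measurable_prod _ fun i _ => ?_
  exact (measurable_one.indicator measurableSet_Ioo).comp (measurable_pi_apply i)

lemma eLpNorm_simpleKernel (c : Box 2 →₀ ℝ) :
    eLpNorm (simpleKernel c) 2 (orthant 2) =
      ENNReal.ofReal √(∫ t, simpleKernel c t ^ 2 ∂(orthant 2)) := by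
  have hm : MemLp (simpleKernel c) 2 (orthant 2) :=
    (memLp_two_iff_integrable_sq (measurable_simpleKernel c).aestronglyMeasurable).2
      (integrable_simpleKernel_sq c)
  rw [hm.eLpNorm_eq_integral_rpow_norm two_ne_zero ENNReal.ofNat_ne_top, Real.sqrt_eq_rpow]
  simp

lemma simpleKernel_sub {q : ℕ} (c c' : Box q →₀ ℝ) :
    simpleKernel (c - c') = simpleKernel c - simpleKernel c' := by
  funext t
  simp only [simpleKernel, Pi.sub_apply]
  exact Finsupp.sum_sub_index fun Q x y => sub_mul _ _ _

/-! ### Wigner integrals of simple functions of two variables -/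

section Integral

variable {H : Type u} [NormedAddCommGroup H] [InnerProductSpace ℂ H] [CompleteSpace H]
  {𝒜 : VonNeumannAlgebra H} {E : 𝒜.toStarSubalgebra →ₗ[ℂ] ℂ}

lemma simpleIntegral_sub (S : ℝ≥0 → 𝒜.toStarSubalgebra) {q : ℕ} (c c' : Box q →₀ ℝ) :
    simpleIntegral S (c - c') = simpleIntegral S c - simpleIntegral S c' :=
  Finsupp.sum_sub_index fun Q x y => by push_cast; exact sub_smul _ _ _

namespace IsFreeBrownianMotion

variable {ℱ : ℝ≥0 → VonNeumannAlgebra H} {S : ℝ≥0 → 𝒜.toStarSubalgebra}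

lemma mem_subalgebraIn (hS : IsFreeBrownianMotion 𝒜 E ℱ S) {s t : ℝ≥0} (hst : s ≤ t) :
    S s ∈ subalgebraIn 𝒜 (ℱ t) :=
  hS.filtration_mono hst (hS.adapted s)

lemma hasFreeIncrements (hS : IsFreeBrownianMotion 𝒜 E ℱ S) (hE : IsTracialState 𝒜 E) :
    HasFreeIncrements E S fun t => subalgebraIn 𝒜 (ℱ t) := by
  have hmem (s t : ℝ≥0) : S t - S s ∈ Algebra.adjoin ℂ {S t - S s} :=
    Algebra.self_mem_adjoin_singleton _ _
  have hmom1 (s t : ℝ≥0) (hst : s < t) : E (S t - S s) = 0 := by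
    have := (hS.increment_distribution s t hst).moment 1
    simpa only [pow_one, integral_id_semicircular, Complex.ofReal_zero] using this
  have hmom2 (s t : ℝ≥0) (hst : s < t) :
      E ((S t - S s) * (S t - S s)) = (((t : ℝ) - (s : ℝ) : ℝ) : ℂ) := by
    have := (hS.increment_distribution s t hst).moment 2
    rwa [integral_sq_semicircular, sq, NNReal.coe_sub hst.le] at this
  refine ⟨hE.tracial, fun s t hst => hS.mem_subalgebraIn hst, ?_, ?_, ?_, ?_, ?_, ?_, ?_⟩
  · intro t
    have := (hS.distribution t).moment 1
    simpa only [pow_one, integral_id_semicircular, Complex.ofReal_zero] using this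
  · intro t
    have := (hS.distribution t).moment 2
    rwa [integral_sq_semicircular, sq] at this
  · intro t
    have := (hS.distribution t).moment 4
    rw [integral_pow_four_semicircular] at this
    rw [show S t * S t * S t * S t = S t ^ 4 by simp only [pow_succ, pow_zero, one_mul], this]
    push_cast; rfl
  · intro s t hst c hc
    rw [(hS.increment_free s t hst).map_mul hE.unital (hmem s t) hc, hmom1 s t hst, zero_mul]
  · intro s t hst c hc
    rw [(hS.increment_free s t hst).map_mul hE.unital
      (Subalgebra.mul_mem _ (hmem s t) (hmem s t)) hc, hmom2 s t hst]
  · intro s t hst c hc hc0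
    rw [(hS.increment_free s t hst).map_mul hE.unital (Subalgebra.mul_mem _
      (Subalgebra.mul_mem _ (hmem s t) (hmem s t)) (hmem s t)) hc, hc0, mul_zero]
  · intro s t hst c hc d hd hc0 hd0
    exact (hS.increment_free s t hst).map_mul_four (hmem s t) hc (hmem s t) hd
      (hmom1 s t hst) hc0 (hmom1 s t hst) hd0

/-- The adjoint reverses the first product. Of the two noncrossing pairings, the one pairing factors
inside a single box vanishes since its sides are disjoint, and the nested one is the inner product
of the indicators. -/
lemma map_box (hS : IsFreeBrownianMotion 𝒜 E ℱ S) (hE : IsTracialState 𝒜 E) (Q Q' : Box 2) :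
    E (star (List.ofFn fun i => S (Q.b i) - S (Q.a i)).prod *
      (List.ofFn fun i => S (Q'.b i) - S (Q'.a i)).prod) = (boxCov Q Q' : ℂ) := by
  have hst (t : ℝ≥0) : star (S t) = S t := (hS.distribution t).selfAdjoint
  have h := (hS.hasFreeIncrements hE).map_increments (Q.a 1) (Q.b 1) (Q.a 0) (Q.b 0)
    (Q'.a 0) (Q'.b 0) (Q'.a 1) (Q'.b 1)
  simp only [List.ofFn_succ, List.ofFn_zero, List.prod_cons, List.prod_nil, mul_one, star_mul,
    star_sub, hst]
  rw [Q.incrCov_eq_zero.2, zero_mul, zero_add] at h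
  rw [← mul_assoc]
  refine h.trans ?_
  rw [boxCov, mul_comm]

/-- The Wigner isometry for simple functions of two variables. -/
lemma map_simpleIntegral (hS : IsFreeBrownianMotion 𝒜 E ℱ S) (hE : IsTracialState 𝒜 E)
    (c : Box 2 →₀ ℝ) :
    E (star (simpleIntegral S c) * simpleIntegral S c) =
      ((∫ t, simpleKernel c t ^ 2 ∂(orthant 2) : ℝ) : ℂ) := by
  rw [integral_simpleKernel_sq]
  simp only [simpleIntegral, Finsupp.sum, star_sum, Finset.sum_mul_sum, map_sum, star_smul,
    smul_mul_assoc, mul_smul_comm, map_smul, hS.map_box hE]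
  push_cast
  refine Finset.sum_congr rfl fun Q _ => Finset.sum_congr rfl fun Q' _ => ?_
  simp only [smul_eq_mul, Complex.star_def, Complex.conj_ofReal]
  ring

end IsFreeBrownianMotion

/-! ### Uniqueness of the Wigner integral -/

namespace IsTracialState

lemma star_mul_self_nonneg (hE : IsTracialState 𝒜 E) (x : 𝒜.toStarSubalgebra) :
    0 ≤ E (star x * x) := by
  rw [hE.tracial]; exact hE.positive x

lemma re_star_mul_self_nonneg (hE : IsTracialState 𝒜 E) (x : 𝒜.toStarSubalgebra) :
    0 ≤ (E (star x * x)).re :=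
  (Complex.le_def.1 (hE.star_mul_self_nonneg x)).1

/-- Parallelogram identity with the square of `x - y` dropped; it serves as the triangle inequality
for the `L²` norm. -/
lemma re_star_add_mul_add_le (hE : IsTracialState 𝒜 E) (x y : 𝒜.toStarSubalgebra) :
    (E (star (x + y) * (x + y))).re ≤ 2 * (E (star x * x)).re + 2 * (E (star y * y)).re := by
  have := hE.re_star_mul_self_nonneg (x - y)
  simp only [star_add, star_sub, add_mul, mul_add, sub_mul, mul_sub, map_add, map_sub,
    Complex.add_re, Complex.sub_re] at this ⊢
  linarith

lemma eq_zero_of_re (hE : IsTracialState 𝒜 E) (x : 𝒜.toStarSubalgebra)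
    (h : (E (star x * x)).re ≤ 0) : x = 0 := by
  refine hE.faithful x ?_
  rw [hE.tracial]
  have := Complex.le_def.1 (hE.star_mul_self_nonneg x)
  exact Complex.ext (le_antisymm h this.1) this.2.symm

end IsTracialState

/-- A simple `c` near `f` is near `c₀`, so by the isometry its integral is near that of `c₀` as well
as near `Y`; faithfulness turns distance zero into equality. -/
lemma isWignerIntegral_iff_of_ae_eq {ℱ : ℝ≥0 → VonNeumannAlgebra H}
    {S : ℝ≥0 → 𝒜.toStarSubalgebra} (hS : IsFreeBrownianMotion 𝒜 E ℱ S)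
    (hE : IsTracialState 𝒜 E) {f : Kernel 2} {c₀ : Box 2 →₀ ℝ}
    (hf : f =ᵐ[orthant 2] simpleKernel c₀) (Y : 𝒜.toStarSubalgebra) :
    IsWignerIntegral E S f Y ↔ Y = simpleIntegral S c₀ := by
  constructor
  · intro hY
    rw [← sub_eq_zero]
    refine hE.eq_zero_of_re _ (le_of_forall_pos_le_add fun δ hδ => ?_)
    -- Two squared distances below `δ / 4`, each doubled by `re_star_add_mul_add_le`, add up to less
    -- than `δ`.
    obtain ⟨c, hc1, hc2⟩ := hY (√(δ / 4)) (by positivity)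
    have h1 : eLpNorm (f - simpleKernel c) 2 (orthant 2) =
        eLpNorm (simpleKernel (c₀ - c)) 2 (orthant 2) := by
      rw [simpleKernel_sub]
      exact eLpNorm_congr_ae (hf.sub ae_eq_rfl)
    rw [h1, eLpNorm_simpleKernel, ENNReal.ofReal_lt_ofReal_iff (by positivity),
      Real.sqrt_lt_sqrt_iff (integral_nonneg fun t => sq_nonneg _)] at hc1
    rw [Real.sqrt_lt_sqrt_iff (hE.re_star_mul_self_nonneg _)] at hc2
    have h2 := hS.map_simpleIntegral hE (c₀ - c)
    have h3 : E (star (simpleIntegral S c - simpleIntegral S c₀) *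
        (simpleIntegral S c - simpleIntegral S c₀)) =
        ((∫ t, simpleKernel (c₀ - c) t ^ 2 ∂(orthant 2) : ℝ) : ℂ) := by
      rw [← h2, simpleIntegral_sub, ← neg_sub (simpleIntegral S c₀), star_neg, neg_mul_neg]
    have h4 := hE.re_star_add_mul_add_le (Y - simpleIntegral S c)
      (simpleIntegral S c - simpleIntegral S c₀)
    rw [h3, Complex.ofReal_re, sub_add_sub_cancel] at h4
    linarith
  · rintro rfl ε hε
    refine ⟨c₀, ?_, ?_⟩
    · rw [eLpNorm_congr_ae (g := 0), eLpNorm_zero]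
      · simpa using hε
      · filter_upwards [hf] with t ht
        simp [ht]
    · simpa using hε

/-! ### The kernel of the tetilla law as a simple function -/

/-- The box `(0,1) × (1,2)`. -/
def boxZeroOne : Box 2 where
  a := ![0, 1]
  b := ![1, 2]
  lt := by simp [Fin.forall_fin_two]
  disjoint := by
    simp [Fin.forall_fin_two, Set.Ioo_disjoint_Ioo]

/-- The box `(1,2) × (0,1)`. -/
def boxOneZero : Box 2 where
  a := ![1, 0]
  b := ![2, 1]
  lt := by simp [Fin.forall_fin_two]
  disjoint := by
    simp [Fin.forall_fin_two, Set.Ioo_disjoint_Ioo]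

/-- The simple function that equals the kernel of the tetilla law almost everywhere. -/
def tetillaSimple : Box 2 →₀ ℝ :=
  Finsupp.single boxZeroOne (1 / √2) + Finsupp.single boxOneZero (1 / √2)

lemma tetillaKernel_ae_eq : tetillaKernel =ᵐ[orthant 2] simpleKernel tetillaSimple := by
  -- Closed and open intervals differ only at the endpoints 0, 1, 2, and a coordinate takes a given
  -- value on a null set.
  have hne (i : Fin 2) (x : ℝ) : ∀ᵐ t ∂(orthant 2), t i ≠ x := by
    refine (Measure.quasiMeasurePreserving_eval
      (fun _ : Fin 2 => volume.restrict (Set.Ici (0 : ℝ))) i).ae (p := fun s => s ≠ x) ?_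
    exact ae_restrict_of_ae (Measure.ae_ne volume x)
  have hI (a b x : ℝ) (ha : x ≠ a) (hb : x ≠ b) :
      (Set.Icc a b).indicator (1 : ℝ → ℝ) x = (Set.Ioo a b).indicator 1 x := by
    have : x ∈ Set.Icc a b ↔ x ∈ Set.Ioo a b := by
      simp [le_iff_lt_or_eq, ha.symm, hb]
    by_cases hx : x ∈ Set.Ioo a b
    · rw [Set.indicator_of_mem hx, Set.indicator_of_mem (this.2 hx)]
    · rw [Set.indicator_of_notMem hx, Set.indicator_of_notMem (this.not.2 hx)]
  filter_upwards [hne 0 0, hne 0 1, hne 0 2, hne 1 0, hne 1 1, hne 1 2]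
    with t h00 h01 h02 h10 h11 h12
  rw [simpleKernel, tetillaSimple, Finsupp.sum_add_index' (by simp) (fun Q x y => add_mul _ _ _),
    Finsupp.sum_single_index (by simp), Finsupp.sum_single_index (by simp), tetillaKernel,
    hI _ _ _ h00 h01, hI _ _ _ h01 h02, hI _ _ _ h10 h11, hI _ _ _ h11 h12]
  simp only [Box.kernel, Fin.prod_univ_two, boxZeroOne, boxOneZero, Matrix.cons_val_zero,
    Matrix.cons_val_one, NNReal.coe_zero, NNReal.coe_one, NNReal.coe_ofNat]
  ring

lemma simpleIntegral_tetillaSimple (S : ℝ≥0 → 𝒜.toStarSubalgebra) :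
    simpleIntegral S tetillaSimple = tetilla (S 2 - S 1) (S 1 - S 0) := by
  rw [simpleIntegral, tetillaSimple, Finsupp.sum_add_index' (by simp)
    (fun Q x y => by push_cast; exact add_smul _ _ _),
    Finsupp.sum_single_index (by simp), Finsupp.sum_single_index (by simp), tetilla, smul_add,
    add_comm]
  simp [boxZeroOne, boxOneZero]

lemma exists_wignerIntegral_tetillaKernel {ℱ : ℝ≥0 → VonNeumannAlgebra H}
    {S : ℝ≥0 → 𝒜.toStarSubalgebra} (hS : IsFreeBrownianMotion 𝒜 E ℱ S)
    (hE : IsTracialState 𝒜 E) :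
    ∃ X : 𝒜.toStarSubalgebra,
      (∀ Y : 𝒜.toStarSubalgebra, IsWignerIntegral E S tetillaKernel Y ↔ Y = X) ∧
      ∀ m : ℕ, 1 ≤ m →
        E (X ^ (2 * m)) = (pathSum tetillaKernel (2 * m) tetillaKernel : ℂ) := by
  refine ⟨simpleIntegral S tetillaSimple,
    isWignerIntegral_iff_of_ae_eq hS hE tetillaKernel_ae_eq, fun m hm => ?_⟩
  rw [simpleIntegral_tetillaSimple]
  have h12 : (1 : ℝ≥0) < 2 := one_lt_two
  have e1 : (2 : ℝ≥0) - 1 = 1 := by rw [← one_add_one_eq_two, add_tsub_cancel_right]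
  have d1 := hS.increment_distribution 1 2 h12
  have d2 := hS.increment_distribution 0 1 one_pos
  rw [e1] at d1
  rw [tsub_zero] at d2
  -- The later increment plays the role of `x`, being free from the algebra at time 1, which
  -- contains the earlier increment.
  exact apply_tetilla_pow hE.unital d1 d2 (hS.increment_free 1 2 h12)
    (Algebra.self_mem_adjoin_singleton _ _)
    (Subalgebra.sub_mem _ (hS.mem_subalgebraIn le_rfl) (hS.mem_subalgebraIn zero_le_one)) m hm

end Integral

end WignerTetilla

end

theorem proposition2p9 :
    -- the two identities satisfied by the kernel
    (contr 1 (by norm_num) tetillaKernelContr tetillaKernel = fun t => (1 / 2) * tetillaKernel t) ∧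
    (∫ t, tetillaKernelContr t * tetillaKernel t ∂(orthant 2) = 0) ∧
    -- the even moments of the tetilla law, and of the Wigner integral of the kernel, are the sums
    (∀ (H : Type u) [NormedAddCommGroup H] [InnerProductSpace ℂ H] [CompleteSpace H]
      (𝒜 : VonNeumannAlgebra H) (E : 𝒜.toStarSubalgebra →ₗ[ℂ] ℂ), IsTracialState 𝒜 E →
      (∀ x y : 𝒜.toStarSubalgebra,
        HasDistribution E x (semicircular 1) → HasDistribution E y (semicircular 1) →
        FreelyIndependent E ![Algebra.adjoin ℂ {x}, Algebra.adjoin ℂ {y}] →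
        ∀ m : ℕ, 1 ≤ m →
          E (tetilla x y ^ (2 * m)) = (pathSum tetillaKernel (2 * m) tetillaKernel : ℂ)) ∧
      (∀ (ℱ : ℝ≥0 → VonNeumannAlgebra H) (S : ℝ≥0 → 𝒜.toStarSubalgebra),
        IsFreeBrownianMotion 𝒜 E ℱ S →
        ∃ X : 𝒜.toStarSubalgebra,
          (∀ Y : 𝒜.toStarSubalgebra, IsWignerIntegral E S tetillaKernel Y ↔ Y = X) ∧
          ∀ m : ℕ, 1 ≤ m →
            E (X ^ (2 * m)) = (pathSum tetillaKernel (2 * m) tetillaKernel : ℂ))) ∧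
    -- the recursion
    (∀ m : ℕ, 2 ≤ m →
      pathSum tetillaKernel (2 * m) tetillaKernel =
        pathSum tetillaKernel (2 * m - 2) tetillaKernel +
        pathSum tetillaKernel (2 * m - 1) tetillaKernelContr +
        ∑ k ∈ Finset.Icc 1 (m - 1), positivePathSum tetillaKernel (2 * k) tetillaKernel *
          pathSum tetillaKernel (2 * m - 2 * k) tetillaKernel ∧
      pathSum tetillaKernel (2 * m - 1) tetillaKernelContr =
        1 / 2 * pathSum tetillaKernel (2 * m - 2) tetillaKernel +
        ∑ k ∈ Finset.Icc 1 (m - 2), positivePathSum tetillaKernel (2 * k) tetillaKernel *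
          pathSum tetillaKernel (2 * m - 2 * k - 1) tetillaKernelContr ∧
      positivePathSum tetillaKernel (2 * m) tetillaKernel =
        positivePathSum tetillaKernel (2 * m - 1) tetillaKernelContr +
        ∑ k ∈ Finset.Icc 1 (m - 1), positivePathSum tetillaKernel (2 * k) tetillaKernel *
          positivePathSum tetillaKernel (2 * m - 2 * k) tetillaKernel ∧
      positivePathSum tetillaKernel (2 * m - 1) tetillaKernelContr =
        1 / 2 * positivePathSum tetillaKernel (2 * m - 2) tetillaKernel +
        ∑ k ∈ Finset.Icc 1 (m - 2), positivePathSum tetillaKernel (2 * k) tetillaKernel *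
          positivePathSum tetillaKernel (2 * m - 2 * k - 1) tetillaKernelContr) ∧
    -- the initial conditions
    pathSum tetillaKernel 2 tetillaKernel = 1 ∧
    pathSum tetillaKernel 3 tetillaKernelContr = 1 / 2 ∧
    positivePathSum tetillaKernel 2 tetillaKernel = 1 ∧
    positivePathSum tetillaKernel 3 tetillaKernelContr = 1 / 2 := by
  refine ⟨contr_tetillaKernelContr, integral_tetillaKernelContr_mul, ?_, tetilla_recursion,
    tetilla_initial⟩
  intro H _ _ _ 𝒜 E hE
  refine ⟨fun x y hx hy hxy m hm => ?_, fun ℱ S hS => exists_wignerIntegral_tetillaKernel hS hE⟩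
  exact apply_tetilla_pow hE.unital hx hy hxy (Algebra.self_mem_adjoin_singleton _ _)
    (Algebra.self_mem_adjoin_singleton _ _) m hm
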